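/- For $m\ge 1$ and $0\le i,j\le m-1$ let $S_{i,j,m}=[\frac im,\frac{i+1}m]\times[\frac jm,\frac{j+1}m]$. An $m$-pattern is a nonempty set $\mathcal A$ of such squares, called the white squares; $m$ is its width. Its graph has the white squares as vertices and the pairs of white squares with a common side as edges. A top exit (bottom exit) of $\mathcal A$ is a white square in the top (bottom) row such that the square of the same column in the bottom (top) row is white too, and these two squares form a vertical exit pair; left and right exits and horizontal exit pairs are defined analogously with rows and columns interchanged. For $m\ge 3$, $\mathcal A$ is a labyrinth pattern if its graph is a tree, it has exactly one vertical and exactly one horizontal exit pair, and no two diagonally opposite corner squares are both white. Given a sequence $(\mathcal A_k)_{k\ge1}$ of labyrinth patterns, let $\mathcal W_1=\mathcal A_1$, and for $n\ge2$ let $\mathcal W_n$ be obtained from $\mathcal W_{n-1}$ by replacing each white square by a scaled copy of $\mathcal A_n$. The mixed labyrinth fractal defined by the sequence is $L_\infty=\bigcap_{n\ge1}\bigcup_{W\in\mathcal W_n}W$, and its top, bottom, left and right exits are the points in which the top, bottom, left and right exits, respectively, of the $\mathcal W_n$, $n\ge 1$, intersect. Theorem. For every $\delta\in[1,2]$ there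 is a mixed labyrinth fractal $L_\infty$, with exactly one exit on each of the four sides, such that any two of its four exits are connected in $L_\infty$ by an arc whose box-counting dimension exists and equals $\delta$. -/

import Mathlib

open Filter Topology

namespace Labyrinth

/-- The Euclidean plane. -/
abbrev Plane : Type := EuclideanSpace ℝ (Fin 2)

/-- The closed square `S_{i,j,m} = [i/m, (i+1)/m] × [j/m, (j+1)/m]`, where `q = (i, j)`. -/
def square (m : ℕ) (q : ℕ × ℕ) : Set Plane :=
  {p | (q.1 : ℝ) / m ≤ p 0 ∧ p 0 ≤ ((q.1 : ℝ) + 1) / m ∧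
       (q.2 : ℝ) / m ≤ p 1 ∧ p 1 ≤ ((q.2 : ℝ) + 1) / m}

/-- A pattern: a nonempty set of squares of the `m × m` grid of the unit square, where `m` is
the width of the pattern. The square `S_{i,j,m}` is encoded by `(i, j)` (column `i`, row `j`,
both counted from `0`; row `0` is the bottom row). The squares in `white` are the white ones. -/
structure Pattern where
  width : ℕ
  white : Finset (ℕ × ℕ)
  white_subset : white ⊆ Finset.range width ×ˢ Finset.range width
  white_nonempty : white.Nonempty

/-- The four sides of the unit square. -/
inductive Side
  | top
  | bottom
  | left
  | right

/-- Two grid squares are adjacent if they have a common side. -/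
def gridGraph : SimpleGraph (ℕ × ℕ) where
  Adj p q := (p.1 = q.1 ∧ (p.2 + 1 = q.2 ∨ q.2 + 1 = p.2)) ∨
    (p.2 = q.2 ∧ (p.1 + 1 = q.1 ∨ q.1 + 1 = p.1))
  symm := ⟨fun p q h => by omega⟩
  loopless := ⟨fun p h => by omega⟩

namespace Pattern

/-- The graph of a pattern: the vertices are the white squares, and the edges are the pairs of
white squares with a common side. -/
def graph (P : Pattern) : SimpleGraph {q : ℕ × ℕ // q ∈ P.white} :=
  gridGraph.comap Subtype.val

/-- `P.IsExit s q`: the white square `q` is an exit of `P` on the side `s`, that is, `q` lies in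
the row or column of `P` along this side, and the square opposite to it, in the row or column
along the opposite side, is white as well. -/
def IsExit (P : Pattern) : Side → ℕ × ℕ → Prop
  | .top, q => q ∈ P.white ∧ q.2 = P.width - 1 ∧ (q.1, 0) ∈ P.white
  | .bottom, q => q ∈ P.white ∧ q.2 = 0 ∧ (q.1, P.width - 1) ∈ P.white
  | .left, q => q ∈ P.white ∧ q.1 = 0 ∧ (P.width - 1, q.2) ∈ P.white
  | .right, q => q ∈ P.white ∧ q.1 = P.width - 1 ∧ (0, q.2) ∈ P.white

/-- Labyrinth patterns: patterns of width at least `3` with the tree property, the exits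
property (exactly one vertical and exactly one horizontal exit pair) and the corner property
(no two diagonally opposite corner squares are both white). -/
structure IsLabyrinth (P : Pattern) : Prop where
  three_le_width : 3 ≤ P.width
  tree : P.graph.IsTree
  vertical_exit_pair : ∃! i, (i, P.width - 1) ∈ P.white ∧ (i, 0) ∈ P.white
  horizontal_exit_pair : ∃! j, (0, j) ∈ P.white ∧ (P.width - 1, j) ∈ P.white
  corner : ¬ ((0, 0) ∈ P.white ∧ (P.width - 1, P.width - 1) ∈ P.white) ∧
    ¬ ((0, P.width - 1) ∈ P.white ∧ (P.width - 1, 0) ∈ P.white)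

/-- Replace every white square of `P` by a scaled copy of the pattern `Q`: the square `r` of `Q`
in the copy placed in the square `q` of `P` is the square `(m q₁ + r₁, m q₂ + r₂)` of the finer
grid, where `m` is the width of `Q`. -/
def refine (P Q : Pattern) : Pattern where
  width := P.width * Q.width
  white := (P.white ×ˢ Q.white).image fun x =>
    (Q.width * x.1.1 + x.2.1, Q.width * x.1.2 + x.2.2)
  white_subset := by
    have key : ∀ a b M m : ℕ, a < M → b < m → m * a + b < M * m := by
      intro a b M m ha hb
      calc m * a + b < m * a + m := by omega
        _ = (a + 1) * m := by ring
        _ ≤ M * m := Nat.mul_le_mul_right m ha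
    intro y hy
    obtain ⟨x, hx, rfl⟩ := Finset.mem_image.1 hy
    obtain ⟨h1, h2⟩ := Finset.mem_product.1 hx
    have h1' := Finset.mem_product.1 (P.white_subset h1)
    have h2' := Finset.mem_product.1 (Q.white_subset h2)
    simp only [Finset.mem_range] at h1' h2'
    simp only [Finset.mem_product, Finset.mem_range]
    exact ⟨key _ _ _ _ h1'.1 h2'.1, key _ _ _ _ h1'.2 h2'.2⟩
  white_nonempty := (P.white_nonempty.product Q.white_nonempty).image _

/-- The union of the white squares of a pattern. -/
def region (P : Pattern) : Set Plane :=
  ⋃ q ∈ P.white, square P.width q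

end Pattern

/-- The set of white squares of each level defined by a sequence of patterns
`A 0, A 1, A 2, …`; the value at `n` is the one of level `n + 1`. -/
def level (A : ℕ → Pattern) : ℕ → Pattern
  | 0 => A 0
  | n + 1 => (level A n).refine (A (n + 1))

/-- The limit set of a sequence of patterns. If all `A k` are labyrinth patterns, this is the
mixed labyrinth fractal defined by the sequence. -/
def limitSet (A : ℕ → Pattern) : Set Plane :=
  ⋂ n, (level A n).region

/-- The point `x` is the exit on the side `s` of the limit set: the intersection, over all
levels, of the exit squares on the side `s` is `{x}`. -/
def IsFractalExit (A : ℕ → Pattern) (s : Side) (x : Plane) : Prop :=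
  ∃ T : ℕ → ℕ × ℕ, (∀ n, (level A n).IsExit s (T n)) ∧
    ⋂ n, square (level A n).width (T n) = {x}

/-- `a` is an arc with end points `x` and `y`: a homeomorphic image of `[0, 1]`. -/
def IsArc (a : Set Plane) (x y : Plane) : Prop :=
  ∃ γ : Path x y, Function.Injective γ ∧ Set.range γ = a

/-- The box-counting dimension of the nonempty bounded set `F` exists and is equal to `d`:
`log N(ε) / (- log ε) → d` as `ε → 0+`, where `N(ε)` is the smallest number of closed discs of
radius `ε` that cover `F`. -/
def HasBoxDim (F : Set Plane) (d : ℝ) : Prop :=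
  F.Nonempty ∧ Bornology.IsBounded F ∧
    Tendsto (fun ε : NNReal =>
      Real.log ((Metric.externalCoveringNumber ε F).toNat : ℝ) / (-Real.log (ε : ℝ)))
      (𝓝[>] 0) (𝓝 d)

end Labyrinth

namespace Labyrinth

/-! The patterns have width `8 * t + 3` and consist of four rotated copies of one arm, a meandering
path ("snake") from the central square to the middle of a side. The height of the arm is fixed by
`t`, while the width `X` of its meanders can be chosen between `0` and `4 * t`. The path between two
sides therefore has `pathLength t X`, about `4 * t * X`, squares, and its length can be tuned from
the order of the width to the order of the width squared.

Fix two sides. Replacing each square of a path by the path through the next pattern that joins the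
same two sides gives paths of all levels. The key invariant is `GoodWalk`: squares are equal or
adjacent only if their indices are (`GoodWalk.refineWalk`). Squares that are not adjacent may still
share a corner, but the paths inside them avoid the corners, so one level later the closed squares
are disjoint (`GoodWalk.apart_refineWalk`). Nested squares with compatible indices define a curve
`γ`. Nearby parameters give adjacent squares, hence continuity; distinct parameters eventually give
disjoint squares, hence injectivity. So `γ` maps `[0, 1]` onto an arc between the two exits.

At scale `1 / M n`, with `M n` the product of the widths, the arc needs as many discs as the path of
level `n` has squares, up to constant factors (`encard_cover_le`, `walkLength_le_covering`). With `t
= k + 1` and `X = ⌊(k + 1) ^ (δ - 1)⌋` in the `k`-th pattern, the logarithm of the path length is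
`δ` times that of the width up to a bounded error. Over `n` levels the errors add up to `O(n)`,
whereas `log (M n)` is at least `log n!`; moreover consecutive scales differ by `O(n)` in logarithm.
Hence the dimension is exactly `δ` (`hasBoxDim_of_scales`). -/

/-! ### The snake as an induced path, and its rotations -/

/-- Two points of the grid are equal or adjacent. -/
def Near (p q : ℤ × ℤ) : Prop :=
  p.1 - q.1 + (p.2 - q.2) ≤ 1 ∧ p.1 - q.1 - (p.2 - q.2) ≤ 1 ∧
    q.1 - p.1 + (p.2 - q.2) ≤ 1 ∧ q.1 - p.1 - (p.2 - q.2) ≤ 1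

/-- The four unit vectors of the grid. -/
def IsDir (d : ℤ × ℤ) : Prop :=
  d.1 = 0 ∧ d.2 = 1 ∨ d.1 = 0 ∧ d.2 = -1 ∨ d.1 = 1 ∧ d.2 = 0 ∨ d.1 = -1 ∧ d.2 = 0

/-- The rotation of the grid that takes `(0, 1)` to `d`. -/
def rot (d v : ℤ × ℤ) : ℤ × ℤ := (v.1 * d.2 + v.2 * d.1, v.2 * d.2 - v.1 * d.1)

/-- An infinite path that starts at the origin and then runs through the even rows
of the strip `0 ≤ x ≤ X`, alternately to the right and to the left. -/
def snake (X n : ℕ) : ℤ × ℤ :=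
  if n ≤ 1 then (0, n) else
    (((if (n - 2) / (X + 2) % 2 = 0 then min ((n - 2) % (X + 2)) X
        else X - (n - 2) % (X + 2) : ℕ) : ℤ),
      ((2 * ((n - 2) / (X + 2)) + 2 + if (n - 2) % (X + 2) = X + 1 then 1 else 0 : ℕ) : ℤ))

theorem snake_zero (X : ℕ) : snake X 0 = (0, 0) := rfl

theorem snake_one (X : ℕ) : snake X 1 = (0, 1) := rfl

/-- One period has `X + 2` squares: the `X + 1` squares of an even row and one connecting square
above its end. At `r = X + 1` the minimum and the truncated subtraction in `snake` hold the
connecting square in the end column. -/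
theorem snake_row {X b r : ℕ} (hr : r ≤ X + 1) :
    (r ≤ X ∧ (snake X (b * (X + 2) + r + 2)).2 = 2 * b + 2 ∨
      r = X + 1 ∧ (snake X (b * (X + 2) + r + 2)).2 = 2 * b + 3) ∧
    (b % 2 = 0 ∧ (r ≤ X ∧ (snake X (b * (X + 2) + r + 2)).1 = r ∨
        r = X + 1 ∧ (snake X (b * (X + 2) + r + 2)).1 = X) ∨
      b % 2 = 1 ∧ (r ≤ X ∧ (snake X (b * (X + 2) + r + 2)).1 = X - r ∨
        r = X + 1 ∧ (snake X (b * (X + 2) + r + 2)).1 = 0)) := by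
  have h1 : (b * (X + 2) + r) / (X + 2) = b := by
    rw [Nat.add_comm, Nat.add_mul_div_right _ _ (by omega), Nat.div_eq_of_lt (by omega)]; omega
  have h2 : (b * (X + 2) + r) % (X + 2) = r := by
    rw [Nat.add_comm, Nat.add_mul_mod_self_right, Nat.mod_eq_of_lt (by omega)]
  have h3 : ¬ (b * (X + 2) + r + 2 ≤ 1) := by omega
  simp only [snake, if_neg h3, Nat.add_sub_cancel, h1, h2]
  constructor
  · split_ifs <;> push_cast <;> omega
  · rcases Nat.mod_two_eq_zero_or_one b with hb | hb <;>
      simp only [hb, reduceIte, one_ne_zero, zero_ne_one, true_and, false_and, or_false,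
        false_or] <;> omega

theorem exists_snake_row (X : ℕ) {n : ℕ} (hn : 2 ≤ n) :
    ∃ b r, r ≤ X + 1 ∧ n = b * (X + 2) + r + 2 := by
  refine ⟨(n - 2) / (X + 2), (n - 2) % (X + 2), ?_, ?_⟩
  · have := Nat.mod_lt (n - 2) (show X + 2 > 0 by omega); omega
  · have := Nat.div_add_mod' (n - 2) (X + 2); omega

/-- Places the arm, without its origin, in a quadrant that is disjoint from its rotations. The last
clause keeps arms in neighbouring quadrants from touching across the common boundary. -/
theorem snake_mem_quadrant (X : ℕ) {n : ℕ} (hn : 1 ≤ n) :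
    0 ≤ (snake X n).1 ∧ (snake X n).1 ≤ X ∧ 1 ≤ (snake X n).2 ∧
      ((snake X n).2 ≤ 1 → (snake X n).1 = 0) := by
  rcases hn.eq_or_lt with rfl | hn
  · simp [snake_one]
  · obtain ⟨b, r, hr, rfl⟩ := exists_snake_row X hn
    have := snake_row (b := b) hr
    omega

theorem snake_near_succ (X n : ℕ) : Near (snake X n) (snake X (n + 1)) := by
  unfold Near
  rcases lt_or_ge n 2 with hn | hn
  · interval_cases n
    · simp [snake_zero, snake_one]
    · have := snake_row (X := X) (b := 0) (r := 0) (by omega)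
      simp only [zero_mul, zero_add] at this ⊢
      simp only [snake_one, Nat.reduceAdd]
      omega
  · obtain ⟨b, r, hr, rfl⟩ := exists_snake_row X hn
    have h := snake_row (b := b) hr
    rcases hr.eq_or_lt with hr | hr
    · have h' := snake_row (X := X) (b := b + 1) (r := 0) (by omega)
      have e : (b + 1) * (X + 2) + 0 + 2 = b * (X + 2) + r + 2 + 1 := by subst hr; ring
      rw [e] at h'
      generalize snake X (b * (X + 2) + r + 2 + 1) = p at *
      generalize snake X (b * (X + 2) + r + 2) = q at *
      omega
    · have h' := snake_row (X := X) (b := b) (r := r + 1) (by omega)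
      have e : b * (X + 2) + (r + 1) + 2 = b * (X + 2) + r + 2 + 1 := by ring
      rw [e] at h'
      generalize snake X (b * (X + 2) + r + 2 + 1) = p at *
      generalize snake X (b * (X + 2) + r + 2) = q at *
      omega

theorem Near.symm {p q : ℤ × ℤ} (h : Near p q) : Near q p := by
  unfold Near at *; omega

/-- Successive full rows are two units apart, so contact between them is possible only through the
connecting square. -/
theorem le_of_snake_near {X n n' : ℕ} (h : Near (snake X n) (snake X n')) : n' ≤ n + 1 := by
  by_contra! hlt
  unfold Near at h
  obtain ⟨b', r', hr', hn'⟩ := exists_snake_row X (show 2 ≤ n' by omega)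
  have h2 := snake_row (b := b') hr'
  rw [← hn'] at h2
  rcases lt_or_ge n 2 with hn | hn
  · interval_cases n
    · simp only [snake_zero] at h
      omega
    · simp only [snake_one] at h
      have : b' = 0 := by omega
      subst this
      omega
  · obtain ⟨b, r, hr, hn⟩ := exists_snake_row X hn
    have h1 := snake_row (b := b) hr
    rw [← hn] at h1
    generalize snake X n = p at *
    generalize snake X n' = q at *
    have hb : b' = b ∨ b' = b + 1 ∨ b' < b := by omega
    rcases hb with rfl | rfl | hb
    · omega
    · rw [add_mul] at hn'
      omega
    · have : (b' + 1) * (X + 2) ≤ b * (X + 2) := Nat.mul_le_mul_right _ hb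
      rw [add_mul] at this
      omega

theorem snake_near_iff {X n n' : ℕ} : Near (snake X n) (snake X n') ↔ n' ≤ n + 1 ∧ n ≤ n' + 1 := by
  refine ⟨fun h => ⟨le_of_snake_near h, le_of_snake_near h.symm⟩, fun h => ?_⟩
  obtain rfl | rfl | rfl : n' = n ∨ n' = n + 1 ∨ n = n' + 1 := by omega
  · simp [Near]
  · exact snake_near_succ X n
  · exact (snake_near_succ X n').symm

theorem rot_near_iff {d p q : ℤ × ℤ} (hd : IsDir d) : Near (rot d p) (rot d q) ↔ Near p q := by
  unfold Near rot
  rcases hd with ⟨h1, h2⟩ | ⟨h1, h2⟩ | ⟨h1, h2⟩ | ⟨h1, h2⟩ <;> simp only [h1, h2] <;> omega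

/-- The arms in two different directions meet only in the origin, and are adjacent only there. -/
theorem arm_near {X n n' : ℕ} {d d' : ℤ × ℤ} (hd : IsDir d) (hd' : IsDir d') (hne : d ≠ d')
    (h : Near (rot d (snake X n)) (rot d' (snake X n'))) : n + n' ≤ 1 := by
  by_contra! hlt
  rw [Ne, Prod.ext_iff] at hne
  rcases Nat.eq_zero_or_pos n with rfl | hn
  · have h0 : rot d (snake X 0) = rot d' (snake X 0) := by simp [snake_zero, rot]
    rw [h0, rot_near_iff hd', snake_near_iff] at h
    omega
  rcases Nat.eq_zero_or_pos n' with rfl | hn'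
  · have h0 : rot d' (snake X 0) = rot d (snake X 0) := by simp [snake_zero, rot]
    rw [h0, rot_near_iff hd, snake_near_iff] at h
    omega
  have q := snake_mem_quadrant X hn
  have q' := snake_mem_quadrant X hn'
  unfold Near rot at h
  generalize snake X n = p at *
  generalize snake X n' = p' at *
  rcases hd with ⟨h1, h2⟩ | ⟨h1, h2⟩ | ⟨h1, h2⟩ | ⟨h1, h2⟩ <;>
  rcases hd' with ⟨h1', h2'⟩ | ⟨h1', h2'⟩ | ⟨h1', h2'⟩ | ⟨h1', h2'⟩ <;>
  simp only [h1, h2, h1', h2', and_self, not_true] at h hne <;> omega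

/-- The number of steps of the snake from the origin to the point `(0, 4 * t + 1)`. -/
def armLength (t X : ℕ) : ℕ := 2 * t * (X + 2) + 1

theorem snake_armLength (t X : ℕ) : snake X (armLength t X) = (0, 4 * (t : ℤ) + 1) := by
  rcases Nat.eq_zero_or_pos t with rfl | ht
  · simp [armLength, snake_one]
  -- Row number `2 * t - 1` is odd, so it is run leftwards and its connecting square lies in column
  -- `0`, at height `2 * (2 * t - 1) + 3`.
  · have h := snake_row (X := X) (b := 2 * t - 1) (r := X + 1) le_rfl
    have e : (2 * t - 1) * (X + 2) + (X + 1) + 2 = armLength t X := by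
      obtain ⟨s, rfl⟩ : ∃ s, t = s + 1 := ⟨t - 1, by omega⟩
      have : 2 * (s + 1) - 1 = 2 * s + 1 := by omega
      rw [this, armLength]; ring
    rw [e] at h
    ext
    · simp only; omega
    · simp only; omega

theorem snake_le {t X n : ℕ} (h : n < armLength t X) : (snake X n).2 ≤ 4 * t := by
  rcases lt_or_ge n 2 with hn | hn
  · interval_cases n
    · simp [snake_zero]
    · simp only [snake_one]
      rcases Nat.eq_zero_or_pos t with rfl | ht
      · simp [armLength] at h
      · omega
  · obtain ⟨b, r, hr, rfl⟩ := exists_snake_row X hn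
    have h' := snake_row (b := b) hr
    unfold armLength at h
    have hb : b < 2 * t := by
      by_contra! hb
      have := Nat.mul_le_mul_right (X + 2) hb
      omega
    rcases (show b + 1 ≤ 2 * t from hb).eq_or_lt with hb | hb
    · rw [← hb, add_mul] at h
      omega
    · omega

/-! ### The path through a single pattern -/

/-- The path through a pattern that comes in on the side `d` and leaves on the side `d'`. -/
def pathCell (t X : ℕ) (d d' : ℤ × ℤ) (i : ℕ) : ℤ × ℤ :=
  if i ≤ armLength t X then rot d (snake X (armLength t X - i))
  else rot d' (snake X (i - armLength t X))

/-- The number of squares of the path through a pattern. -/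
def pathLength (t X : ℕ) : ℕ := 2 * armLength t X + 1

theorem pathLength_pos (t X : ℕ) : 0 < pathLength t X := by unfold pathLength; omega

section pathCell

variable {t X : ℕ} {d d' : ℤ × ℤ}

theorem pathCell_near_iff (hd : IsDir d) (hd' : IsDir d') (hne : d ≠ d') {i i' : ℕ} :
    Near (pathCell t X d d' i) (pathCell t X d d' i') ↔ i ≤ i' + 1 ∧ i' ≤ i + 1 := by
  have h0 : rot d' (snake X 0) = rot d (snake X 0) := by simp [snake_zero, rot]
  unfold pathCell
  split_ifs with h h' h'
  · rw [rot_near_iff hd, snake_near_iff]; omega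
  · constructor
    · intro H
      have := arm_near hd hd' hne H
      omega
    · intro H
      rw [show armLength t X - i = 0 by omega, ← h0, rot_near_iff hd', snake_near_iff]
      omega
  · constructor
    · intro H
      have := arm_near hd' hd hne.symm H
      omega
    · intro H
      rw [show armLength t X - i' = 0 by omega, ← h0, rot_near_iff hd', snake_near_iff]
      omega
  · rw [rot_near_iff hd', snake_near_iff]; omega

/-- Only the last square of an arm lies on the border: before it the height is at most `4 * t`, and
`hX` bounds the sideways extent. -/
theorem arm_cases (hX : X ≤ 4 * t) (hd : IsDir d) {n : ℕ} (hn : n ≤ armLength t X) :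
    (-(4 * t : ℤ) ≤ (rot d (snake X n)).1 ∧ (rot d (snake X n)).1 ≤ 4 * t ∧
      -(4 * t : ℤ) ≤ (rot d (snake X n)).2 ∧ (rot d (snake X n)).2 ≤ 4 * t) ∨
    n = armLength t X ∧ (rot d (snake X n)).1 = (4 * t + 1) * d.1 ∧
      (rot d (snake X n)).2 = (4 * t + 1) * d.2 := by
  rcases hn.eq_or_lt with rfl | hn
  · right
    simp [snake_armLength, rot]
  · left
    have h1 := snake_le hn
    have h2 : 0 ≤ (snake X n).1 ∧ (snake X n).1 ≤ X ∧ 0 ≤ (snake X n).2 := by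
      rcases Nat.eq_zero_or_pos n with rfl | h
      · simp [snake_zero]
      · have := snake_mem_quadrant X h
        omega
    unfold rot
    rcases hd with ⟨h1, h2⟩ | ⟨h1, h2⟩ | ⟨h1, h2⟩ | ⟨h1, h2⟩ <;> simp only [h1, h2] <;> omega

theorem pathCell_cases (hX : X ≤ 4 * t) (hd : IsDir d) (hd' : IsDir d') {i : ℕ}
    (hi : i < pathLength t X) :
    (-(4 * t : ℤ) ≤ (pathCell t X d d' i).1 ∧ (pathCell t X d d' i).1 ≤ 4 * t ∧
      -(4 * t : ℤ) ≤ (pathCell t X d d' i).2 ∧ (pathCell t X d d' i).2 ≤ 4 * t) ∨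
    i = 0 ∧ (pathCell t X d d' i).1 = (4 * t + 1) * d.1 ∧
      (pathCell t X d d' i).2 = (4 * t + 1) * d.2 ∨
    i = 2 * armLength t X ∧ (pathCell t X d d' i).1 = (4 * t + 1) * d'.1 ∧
      (pathCell t X d d' i).2 = (4 * t + 1) * d'.2 := by
  unfold pathLength at hi
  unfold pathCell
  split_ifs with h
  · rcases arm_cases hX hd (n := armLength t X - i) (by omega) with H | ⟨H, H'⟩
    · exact .inl H
    · exact .inr (.inl ⟨by unfold armLength at *; omega, H'⟩)
  · rcases arm_cases hX hd' (n := i - armLength t X) (by omega) with H | ⟨H, H'⟩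
    · exact .inl H
    · exact .inr (.inr ⟨by omega, H'⟩)

theorem pathCell_bounds (hX : X ≤ 4 * t) (hd : IsDir d) (hd' : IsDir d') {i : ℕ}
    (hi : i < pathLength t X) :
    -(4 * t + 1 : ℤ) ≤ (pathCell t X d d' i).1 ∧ (pathCell t X d d' i).1 ≤ 4 * t + 1 ∧
      -(4 * t + 1 : ℤ) ≤ (pathCell t X d d' i).2 ∧ (pathCell t X d d' i).2 ≤ 4 * t + 1 := by
  rcases pathCell_cases hX hd hd' hi with h | ⟨-, h, h'⟩ | ⟨-, h, h'⟩
  · omega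
  · rcases hd with ⟨h3, h4⟩ | ⟨h3, h4⟩ | ⟨h3, h4⟩ | ⟨h3, h4⟩ <;> rw [h3] at h <;>
      rw [h4] at h' <;> omega
  · rcases hd' with ⟨h3, h4⟩ | ⟨h3, h4⟩ | ⟨h3, h4⟩ | ⟨h3, h4⟩ <;> rw [h3] at h <;>
      rw [h4] at h' <;> omega

/-- The path meets the side `d'` only in its final square; with the mirror statement for `d`, this
lets the paths in consecutive squares touch at one place only. -/
theorem eq_last_of_pathCell (hX : X ≤ 4 * t) (hd : IsDir d) (hd' : IsDir d') (hne : d ≠ d')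
    {i : ℕ} (hi : i < pathLength t X)
    (h : 4 * t + 1 ≤ d'.1 * (pathCell t X d d' i).1 + d'.2 * (pathCell t X d d' i).2) :
    i = 2 * armLength t X := by
  have c := pathCell_cases hX hd hd' hi
  rw [Ne, Prod.ext_iff] at hne
  generalize pathCell t X d d' i = v at *
  rcases hd' with ⟨h1, h2⟩ | ⟨h1, h2⟩ | ⟨h1, h2⟩ | ⟨h1, h2⟩ <;>
  rcases hd with ⟨h3, h4⟩ | ⟨h3, h4⟩ | ⟨h3, h4⟩ | ⟨h3, h4⟩ <;>
  simp only [h1, h2, h3, h4, and_self, not_true] at h c hne <;> omega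

theorem eq_zero_of_pathCell (hX : X ≤ 4 * t) (hd : IsDir d) (hd' : IsDir d') (hne : d ≠ d')
    {i : ℕ} (hi : i < pathLength t X)
    (h : 4 * t + 1 ≤ d.1 * (pathCell t X d d' i).1 + d.2 * (pathCell t X d d' i).2) :
    i = 0 := by
  have c := pathCell_cases hX hd hd' hi
  rw [Ne, Prod.ext_iff] at hne
  generalize pathCell t X d d' i = v at *
  rcases hd' with ⟨h1, h2⟩ | ⟨h1, h2⟩ | ⟨h1, h2⟩ | ⟨h1, h2⟩ <;>
  rcases hd with ⟨h3, h4⟩ | ⟨h3, h4⟩ | ⟨h3, h4⟩ | ⟨h3, h4⟩ <;>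
  simp only [h1, h2, h3, h4, and_self, not_true] at h c hne <;> omega

theorem pathCell_zero :
    pathCell t X d d' 0 = ((4 * (t : ℤ) + 1) * d.1, (4 * (t : ℤ) + 1) * d.2) := by
  simp [pathCell, snake_armLength, rot]

theorem pathCell_last :
    pathCell t X d d' (2 * armLength t X) =
      ((4 * (t : ℤ) + 1) * d'.1, (4 * (t : ℤ) + 1) * d'.2) := by
  have h : ¬ 2 * armLength t X ≤ armLength t X := by unfold armLength; omega
  rw [pathCell, if_neg h, show 2 * armLength t X - armLength t X = armLength t X by omega,
    snake_armLength]
  simp [rot]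

end pathCell

/-! ### Bi-infinite induced walks and their refinement -/

/-- A path of grid squares, infinite in both directions, in which two squares are equal or
adjacent only if their indices are. -/
def GoodWalk (P : ℤ → ℤ × ℤ) : Prop :=
  ∀ j j', Near (P j) (P j') ↔ j ≤ j' + 1 ∧ j' ≤ j + 1

theorem isDir_sub {p q : ℤ × ℤ} (h : Near p q) (hne : p ≠ q) : IsDir (q - p) := by
  rw [Ne, Prod.ext_iff] at hne
  unfold Near at h
  simp only [IsDir, Prod.fst_sub, Prod.snd_sub]
  omega

namespace GoodWalk

variable {P : ℤ → ℤ × ℤ}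

theorem isDir_next (h : GoodWalk P) (j : ℤ) : IsDir (P (j + 1) - P j) := by
  refine isDir_sub ((h _ _).2 (by omega)) fun he => ?_
  -- If `P j = P (j + 1)`, then `P (j + 2)` would be near `P j`, although the indices differ by two.
  have := (h (j + 2) (j + 1)).2 (by omega)
  rw [← he, h] at this
  omega

theorem isDir_prev (h : GoodWalk P) (j : ℤ) : IsDir (P (j - 1) - P j) := by
  refine isDir_sub ((h _ _).2 (by omega)) fun he => ?_
  have := (h (j - 2) (j - 1)).2 (by omega)
  rw [← he, h] at this
  omega

theorem prev_ne_next (h : GoodWalk P) (j : ℤ) : P (j - 1) - P j ≠ P (j + 1) - P j := by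
  intro he
  have := (h (j - 1) (j + 1)).1 (by simp [sub_left_inj.1 he, Near])
  omega

end GoodWalk

/-- The path of the squares of the finer grid that arises from the path `P` when the pattern
with the parameters `t`, `X` is put into every square. -/
def refineWalk (t X : ℕ) (P : ℤ → ℤ × ℤ) (k : ℤ) : ℤ × ℤ :=
  (((8 * t + 3 : ℕ) : ℤ) * (P (k / pathLength t X)).1,
      ((8 * t + 3 : ℕ) : ℤ) * (P (k / pathLength t X)).2) +
    pathCell t X (P (k / pathLength t X - 1) - P (k / pathLength t X))
      (P (k / pathLength t X + 1) - P (k / pathLength t X)) (k % pathLength t X).toNat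

theorem refineWalk_apply (t X : ℕ) (P : ℤ → ℤ × ℤ) (j : ℤ) {i : ℕ} (hi : i < pathLength t X) :
    refineWalk t X P (pathLength t X * j + i) =
      ((8 * t + 3) * (P j).1 + (pathCell t X (P (j - 1) - P j) (P (j + 1) - P j) i).1,
        (8 * t + 3) * (P j).2 + (pathCell t X (P (j - 1) - P j) (P (j + 1) - P j) i).2) := by
  have h0 : (0 : ℤ) < pathLength t X := by exact_mod_cast pathLength_pos t X
  have h1 : (pathLength t X * j + i : ℤ) / pathLength t X = j := by
    rw [Int.mul_add_ediv_left _ _ h0.ne', Int.ediv_eq_zero_of_lt (by omega) (by omega), add_zero]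
  have h2 : ((pathLength t X * j + i : ℤ) % pathLength t X).toNat = i := by
    rw [Int.mul_add_emod_self_left, Int.emod_eq_of_lt (by omega) (by omega), Int.toNat_natCast]
  unfold refineWalk
  rw [h1, h2]
  simp [Prod.ext_iff]

theorem exists_eq_mul_add (L : ℕ) (hL : 0 < L) (k : ℤ) :
    ∃ j : ℤ, ∃ i : ℕ, i < L ∧ k = L * j + i := by
  have h0 : (0 : ℤ) < L := by exact_mod_cast hL
  refine ⟨k / L, (k % L).toNat, ?_, ?_⟩
  · have := Int.emod_lt_of_pos k h0
    have := Int.emod_nonneg k h0.ne'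
    omega
  · rw [Int.toNat_of_nonneg (Int.emod_nonneg k h0.ne')]
    exact (Int.mul_ediv_add_emod k L).symm

/-- The closed squares of the grid with the given indices are disjoint. -/
def Apart (p q : ℤ × ℤ) : Prop :=
  p.1 + 2 ≤ q.1 ∨ q.1 + 2 ≤ p.1 ∨ p.2 + 2 ≤ q.2 ∨ q.2 + 2 ≤ p.2

/-- The hypotheses on `v` and `w` say that a subsquare on the border is the middle one of a side.
Hence even two coarse squares with a common corner contain no such subsquares that touch each other.
-/
theorem apart_refine {R : ℤ} (hR : 0 < R) {p q v w : ℤ × ℤ} (hpq : ¬ Near p q)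
    (hv : (-R < v.1 ∧ v.1 < R ∨ v.2 = 0) ∧ (-R < v.2 ∧ v.2 < R ∨ v.1 = 0) ∧
      (-R ≤ v.1 ∧ v.1 ≤ R ∧ -R ≤ v.2 ∧ v.2 ≤ R))
    (hw : (-R < w.1 ∧ w.1 < R ∨ w.2 = 0) ∧ (-R < w.2 ∧ w.2 < R ∨ w.1 = 0) ∧
      (-R ≤ w.1 ∧ w.1 ≤ R ∧ -R ≤ w.2 ∧ w.2 ≤ R)) :
    Apart ((2 * R + 1) * p.1 + v.1, (2 * R + 1) * p.2 + v.2)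
      ((2 * R + 1) * q.1 + w.1, (2 * R + 1) * q.2 + w.2) := by
  have aux : ∀ a b : ℤ, a + 2 ≤ b → (2 * R + 1) * a + 2 * (2 * R + 1) ≤ (2 * R + 1) * b := by
    intro a b hab
    have := mul_le_mul_of_nonneg_left hab (show 0 ≤ 2 * R + 1 by omega)
    linarith
  unfold Apart
  unfold Near at hpq
  simp only
  by_cases h1 : p.1 + 2 ≤ q.1
  · have := aux _ _ h1; omega
  by_cases h2 : q.1 + 2 ≤ p.1
  · have := aux _ _ h2; omega
  by_cases h3 : p.2 + 2 ≤ q.2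
  · have := aux _ _ h3; omega
  by_cases h4 : q.2 + 2 ≤ p.2
  · have := aux _ _ h4; omega
  -- What remains is the case of diagonal neighbours.
  have hx : q.1 = p.1 + 1 ∨ q.1 = p.1 - 1 := by omega
  have hy : q.2 = p.2 + 1 ∨ q.2 = p.2 - 1 := by omega
  rcases hx with hx | hx <;> rcases hy with hy | hy <;>
    simp only [hx, hy, mul_add, mul_sub, mul_one] <;> omega

section refineWalk

variable {t X : ℕ} {P : ℤ → ℤ × ℤ}

theorem GoodWalk.apart_refineWalk (hX : X ≤ 4 * t) (hP : GoodWalk P) {j j' : ℤ} {i i' : ℕ}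
    (hi : i < pathLength t X) (hi' : i' < pathLength t X) (hj : j + 2 ≤ j' ∨ j' + 2 ≤ j) :
    Apart (refineWalk t X P (pathLength t X * j + i))
      (refineWalk t X P (pathLength t X * j' + i')) := by
  rw [refineWalk_apply t X P j hi, refineWalk_apply t X P j' hi']
  have key : ∀ (j : ℤ) {i : ℕ}, i < pathLength t X → ∀ v,
      v = pathCell t X (P (j - 1) - P j) (P (j + 1) - P j) i →
      (-(4 * t + 1 : ℤ) < v.1 ∧ v.1 < 4 * t + 1 ∨ v.2 = 0) ∧
      (-(4 * t + 1 : ℤ) < v.2 ∧ v.2 < 4 * t + 1 ∨ v.1 = 0) ∧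
      (-(4 * t + 1 : ℤ) ≤ v.1 ∧ v.1 ≤ 4 * t + 1 ∧ -(4 * t + 1 : ℤ) ≤ v.2 ∧ v.2 ≤ 4 * t + 1) := by
    rintro j i hi v rfl
    have h1 := hP.isDir_prev j
    have h2 := hP.isDir_next j
    have := pathCell_cases hX h1 h2 hi
    generalize P (j - 1) - P j = d at *
    generalize P (j + 1) - P j = d' at *
    rcases this with h | ⟨-, h, h'⟩ | ⟨-, h, h'⟩
    · omega
    · rcases h1 with ⟨h3, h4⟩ | ⟨h3, h4⟩ | ⟨h3, h4⟩ | ⟨h3, h4⟩ <;> rw [h3] at h <;>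
        rw [h4] at h' <;> omega
    · rcases h2 with ⟨h3, h4⟩ | ⟨h3, h4⟩ | ⟨h3, h4⟩ | ⟨h3, h4⟩ <;> rw [h3] at h <;>
        rw [h4] at h' <;> omega
  have := apart_refine (R := 4 * t + 1) (by omega) (p := P j) (q := P j')
    (by rw [hP]; omega) (key j hi _ rfl) (key j' hi' _ rfl)
  convert this using 3 <;> ring

theorem Apart.not_near {p q : ℤ × ℤ} (h : Apart p q) : ¬ Near p q := by
  unfold Apart at h; unfold Near; omega

/-- Within one coarse square the path is induced. Two consecutive coarse squares share a side, which
one path reaches only at its end and the next one only at its start. -/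
theorem GoodWalk.refineWalk_near (hX : X ≤ 4 * t) (hP : GoodWalk P) {j j' : ℤ} {i i' : ℕ}
    (hi : i < pathLength t X) (hi' : i' < pathLength t X) (hj : j' = j ∨ j' = j + 1) :
    Near (refineWalk t X P (pathLength t X * j + i))
      (refineWalk t X P (pathLength t X * j' + i')) ↔
    j' = j ∧ i ≤ i' + 1 ∧ i' ≤ i + 1 ∨ j' = j + 1 ∧ i = 2 * armLength t X ∧ i' = 0 := by
  rw [refineWalk_apply t X P j hi, refineWalk_apply t X P j' hi']
  have hd := hP.isDir_prev j
  have hd' := hP.isDir_next j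
  have hne := hP.prev_ne_next j
  rcases hj with rfl | rfl
  · have := pathCell_near_iff (t := t) (X := X) hd hd' hne (i := i) (i' := i')
    have h2 : ¬ (j' = j' + 1 ∧ i = 2 * armLength t X ∧ i' = 0) := by omega
    simp only [h2, or_false, true_and]
    rw [← this]
    unfold Near
    omega
  · have h2 : ¬ (j + 1 = j ∧ i ≤ i' + 1 ∧ i' ≤ i + 1) := by omega
    simp only [h2, false_or, true_and]
    have e : P (j + 1 - 1) - P (j + 1) = - (P (j + 1) - P j) := by
      rw [add_sub_cancel_right, neg_sub]
    have he := hP.isDir_prev (j + 1)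
    have he' := hP.isDir_next (j + 1)
    have hne' := hP.prev_ne_next (j + 1)
    rw [e] at he hne' ⊢
    have q1 : (P (j + 1)).1 = (P j).1 + (P (j + 1) - P j).1 := by simp
    have q2 : (P (j + 1)).2 = (P j).2 + (P (j + 1) - P j).2 := by simp
    constructor
    · intro H
      have c := pathCell_bounds hX hd hd' hi
      have c' := pathCell_bounds hX he he' hi'
      have l := eq_last_of_pathCell hX hd hd' hne hi
      have l' := eq_zero_of_pathCell hX he he' hne' hi'
      rw [q1, q2] at H
      simp only [Prod.fst_neg, Prod.snd_neg] at l'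
      unfold Near at H
      simp only [mul_add] at H
      generalize pathCell t X (P (j - 1) - P j) (P (j + 1) - P j) i = v at *
      generalize pathCell t X (-(P (j + 1) - P j)) (P (j + 1 + 1) - P (j + 1)) i' = v' at *
      rcases hd' with ⟨h1, h2⟩ | ⟨h1, h2⟩ | ⟨h1, h2⟩ | ⟨h1, h2⟩ <;>
        rw [h1, h2] at H l l' <;> exact ⟨l (by omega), l' (by omega)⟩
    · rintro ⟨rfl, rfl⟩
      rw [pathCell_last, pathCell_zero, q1, q2]
      simp only [Prod.fst_neg, Prod.snd_neg, Near]
      rcases hd' with ⟨h1, h2⟩ | ⟨h1, h2⟩ | ⟨h1, h2⟩ | ⟨h1, h2⟩ <;> rw [h1, h2] <;>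
        simp only [mul_add] <;> omega

theorem GoodWalk.refineWalk (hX : X ≤ 4 * t) (hP : GoodWalk P) :
    GoodWalk (refineWalk t X P) := by
  have key : ∀ k k', k ≤ k' →
      (Near (Labyrinth.refineWalk t X P k) (Labyrinth.refineWalk t X P k') ↔ k' ≤ k + 1) := by
    intro k k' hk
    obtain ⟨j, i, hi, rfl⟩ := exists_eq_mul_add _ (pathLength_pos t X) k
    obtain ⟨j', i', hi', rfl⟩ := exists_eq_mul_add _ (pathLength_pos t X) k'
    have aux : ∀ a b : ℤ, a ≤ b → (pathLength t X : ℤ) * a ≤ pathLength t X * b :=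
      fun a b hab => mul_le_mul_of_nonneg_left hab (by omega)
    have hj : j ≤ j' := by
      by_contra! hlt
      have := aux _ _ (show j' + 1 ≤ j from hlt)
      rw [mul_add] at this
      omega
    obtain hj | hj : (j' = j ∨ j' = j + 1) ∨ j + 2 ≤ j' := by omega
    · rw [hP.refineWalk_near hX hi hi' hj]
      unfold pathLength at *
      rcases hj with rfl | rfl
      · omega
      · rw [mul_add]
        push_cast
        omega
    · refine iff_of_false (hP.apart_refineWalk hX hi hi' (.inl hj)).not_near ?_
      have := aux _ _ hj
      rw [mul_add] at this
      omega
  intro k k'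
  rcases le_total k k' with h | h
  · rw [key k k' h]; omega
  · have := key k' k h
    rw [show Near (Labyrinth.refineWalk t X P k) (Labyrinth.refineWalk t X P k') ↔
      Near (Labyrinth.refineWalk t X P k') (Labyrinth.refineWalk t X P k) from
        ⟨Near.symm, Near.symm⟩, this]
    omega

end refineWalk

/-! ### The snake patterns and their tree property -/

/-- A finite graph is a tree if every vertex except a root has a parent of smaller rank,
and each edge joins a vertex with its parent. -/
theorem isTree_of_parent {V : Type*} [Finite V] (G : SimpleGraph V) (root : V) (p : V → V)
    (rk : V → ℕ) (hp : ∀ v, v ≠ root → G.Adj v (p v) ∧ rk (p v) < rk v)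
    (h : ∀ u v, G.Adj u v → (u ≠ root ∧ v = p u) ∨ (v ≠ root ∧ u = p v)) : G.IsTree := by
  have hreach : ∀ n v, rk v = n → G.Reachable v root := by
    intro n
    induction n using Nat.strong_induction_on with
    | _ n ih =>
      intro v hv
      by_cases hr : v = root
      · rw [hr]
      · obtain ⟨h1, h2⟩ := hp v hr
        exact h1.reachable.trans (ih _ (hv ▸ h2) _ rfl)
  have hconn : G.Connected :=
    { preconnected := fun u v => (hreach _ u rfl).trans (hreach _ v rfl).symm
      nonempty := ⟨root⟩ }
  refine SimpleGraph.isTree_iff_connected_and_card.2 ⟨hconn, ?_⟩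
  have h1 := hconn.card_vert_le_card_edgeSet_add_one
  -- Sending a vertex to its parent edge hits every edge, so there are fewer edges than vertices;
  -- connectedness gives the opposite bound.
  let f : {v // v ≠ root} → G.edgeSet := fun v => ⟨s(v.1, p v.1), (hp v.1 v.2).1⟩
  have hf : Function.Surjective f := by
    rintro ⟨e, he⟩
    induction e using Sym2.ind with
    | _ u v =>
      rcases h u v he with ⟨hu, rfl⟩ | ⟨hv, rfl⟩
      · exact ⟨⟨u, hu⟩, rfl⟩
      · exact ⟨⟨v, hv⟩, Subtype.ext Sym2.eq_swap⟩
  have h2 := Nat.card_le_card_of_surjective f hf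
  have h3 : Nat.card {v // v ≠ root} + 1 = Nat.card V := by
    classical
    have := Fintype.ofFinite V
    simp only [Nat.card_eq_fintype_card, Fintype.card_subtype_compl, Fintype.card_subtype_eq]
    have := Fintype.card_pos_iff.2 ⟨root⟩
    omega
  omega

/-- Makes the number of steps from the centre a well-defined rank of a white square, whichever arm
is used to describe it. -/
theorem arm_inj {X n n' : ℕ} {d d' : ℤ × ℤ} (hd : IsDir d) (hd' : IsDir d')
    (h : rot d (snake X n) = rot d' (snake X n')) : n = n' := by
  rcases eq_or_ne d d' with rfl | hne
  · have key : ∀ {n n' : ℕ}, rot d (snake X n) = rot d (snake X n') → n ≤ n' := by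
      intro n n' h
      have h1 : Near (rot d (snake X (n + 1))) (rot d (snake X n')) := by
        rw [← h, rot_near_iff hd, snake_near_iff]; omega
      rw [rot_near_iff hd, snake_near_iff] at h1
      omega
    exact le_antisymm (key h) (key h.symm)
  · have h1 : Near (rot d (snake X (n + 1))) (rot d' (snake X n')) := by
      rw [← h, rot_near_iff hd, snake_near_iff]; omega
    have h2 : Near (rot d (snake X n)) (rot d' (snake X (n' + 1))) := by
      rw [h, rot_near_iff hd', snake_near_iff]; omega
    have := arm_near hd hd' hne h1
    have := arm_near hd hd' hne h2
    omega

/-- The four unit vectors as a finite set. -/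
def dirs : Finset (ℤ × ℤ) := {(0, 1), (0, -1), (1, 0), (-1, 0)}

theorem mem_dirs {d : ℤ × ℤ} : d ∈ dirs ↔ IsDir d := by
  simp [dirs, IsDir, Prod.ext_iff]

theorem arm_bounds {t X n : ℕ} {d : ℤ × ℤ} (hX : X ≤ 4 * t) (hd : IsDir d)
    (hn : n ≤ armLength t X) :
    -(4 * t + 1 : ℤ) ≤ (rot d (snake X n)).1 ∧ (rot d (snake X n)).1 ≤ 4 * t + 1 ∧
      -(4 * t + 1 : ℤ) ≤ (rot d (snake X n)).2 ∧ (rot d (snake X n)).2 ≤ 4 * t + 1 := by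
  rcases arm_cases hX hd hn with h | ⟨-, h, h'⟩
  · omega
  · rcases hd with ⟨h3, h4⟩ | ⟨h3, h4⟩ | ⟨h3, h4⟩ | ⟨h3, h4⟩ <;> rw [h3] at h <;>
      rw [h4] at h' <;> omega

/-- The pattern of width `8 * t + 3` that consists of four rotated copies of the initial segment
of the snake from the central square to the middle of a side. -/
def snakePattern (t X : ℕ) (hX : X ≤ 4 * t) : Pattern where
  width := 8 * t + 3
  white := (Finset.range (armLength t X + 1) ×ˢ dirs).image fun x =>
    (((rot x.2 (snake X x.1)).1 + (4 * t + 1)).toNat,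
      ((rot x.2 (snake X x.1)).2 + (4 * t + 1)).toNat)
  white_subset := by
    intro q hq
    obtain ⟨x, hx, rfl⟩ := Finset.mem_image.1 hq
    simp only [Finset.mem_product, Finset.mem_range, mem_dirs] at hx
    have := arm_bounds hX hx.2 (n := x.1) (by omega)
    simp only [Finset.mem_product, Finset.mem_range]
    omega
  white_nonempty := by
    refine Finset.Nonempty.image (Finset.Nonempty.product ⟨0, by simp⟩ ⟨(0, 1), ?_⟩) _
    simp [dirs]

theorem mem_white_snakePattern {t X : ℕ} {hX : X ≤ 4 * t} {q : ℕ × ℕ} :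
    q ∈ (snakePattern t X hX).white ↔ ∃ n ≤ armLength t X, ∃ d, IsDir d ∧
      (q.1 : ℤ) = (rot d (snake X n)).1 + (4 * t + 1) ∧
      (q.2 : ℤ) = (rot d (snake X n)).2 + (4 * t + 1) := by
  simp only [snakePattern, Finset.mem_image, Finset.mem_product, Finset.mem_range, mem_dirs]
  constructor
  · rintro ⟨⟨n, d⟩, ⟨hn, hd⟩, rfl⟩
    have := arm_bounds hX hd (n := n) (by omega)
    simp only at this ⊢
    exact ⟨n, by omega, d, hd, by omega, by omega⟩
  · rintro ⟨n, hn, d, hd, h1, h2⟩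
    exact ⟨(n, d), ⟨by omega, hd⟩, Prod.ext (by simp only; omega) (by simp only; omega)⟩

/-- The root is the centre, and the parent of a square is the preceding one on its arm. By
`arm_near`, adjacent squares assigned to different arms include the centre. -/
theorem snakePattern_isTree (t X : ℕ) (hX : X ≤ 4 * t) : (snakePattern t X hX).graph.IsTree := by
  have hw : ∀ v : {q : ℕ × ℕ // q ∈ (snakePattern t X hX).white}, ∃ n d, n ≤ armLength t X ∧
      IsDir d ∧ (v.1.1 : ℤ) = (rot d (snake X n)).1 + (4 * t + 1) ∧
      (v.1.2 : ℤ) = (rot d (snake X n)).2 + (4 * t + 1) := by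
    intro v
    obtain ⟨n, hn, d, h⟩ := mem_white_snakePattern.1 v.2
    exact ⟨n, d, hn, h⟩
  choose rk dr hrk hdr h1 h2 using hw
  -- Outside the valid range of `n` and `d` any white square serves as a default, so that `f` is
  -- total.
  have hf : ∀ n d, ∃ v : {q : ℕ × ℕ // q ∈ (snakePattern t X hX).white},
      n ≤ armLength t X → IsDir d → (v.1.1 : ℤ) = (rot d (snake X n)).1 + (4 * t + 1) ∧
      (v.1.2 : ℤ) = (rot d (snake X n)).2 + (4 * t + 1) := by
    intro n d
    by_cases h : n ≤ armLength t X ∧ IsDir d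
    · have hb := arm_bounds hX h.2 h.1
      refine ⟨⟨(((rot d (snake X n)).1 + (4 * t + 1)).toNat,
        ((rot d (snake X n)).2 + (4 * t + 1)).toNat), mem_white_snakePattern.2
          ⟨n, h.1, d, h.2, ?_, ?_⟩⟩, fun _ _ => ⟨?_, ?_⟩⟩ <;> simp only <;> omega
    · obtain ⟨q, hq⟩ := (snakePattern t X hX).white_nonempty
      exact ⟨⟨q, hq⟩, fun h3 h4 => absurd ⟨h3, h4⟩ h⟩
  choose f hf using hf
  have hup : IsDir (0, 1) := by simp [IsDir]
  have hfr : ∀ n d, n ≤ armLength t X → IsDir d → rk (f n d) = n := by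
    intro n d hn hd
    have h3 := hf n d hn hd
    have h4 := h1 (f n d)
    have h5 := h2 (f n d)
    exact arm_inj (X := X) (hdr (f n d)) hd (Prod.ext (by omega) (by omega))
  have hext : ∀ n d v, n ≤ armLength t X → IsDir d →
      rot (dr v) (snake X (rk v)) = rot d (snake X n) → v = f n d := by
    intro n d v hn hd h
    have h3 := hf n d hn hd
    have h4 := h1 v
    have h5 := h2 v
    rw [h] at h4 h5
    exact Subtype.ext (Prod.ext (by omega) (by omega))
  -- All arms share the centre, so the direction chosen for it by `dr` is immaterial.
  have hhub : ∀ d d' : ℤ × ℤ, rot d (snake X 0) = rot d' (snake X 0) := by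
    intro d d'; simp [rot, snake_zero]
  have hroot : ∀ v, v ≠ f 0 (0, 1) → rk v ≠ 0 := by
    intro v hv h0
    refine hv (hext _ _ _ (by omega) hup ?_)
    rw [h0]
    exact hhub _ _
  have hadj : ∀ u v, (snakePattern t X hX).graph.Adj u v ↔
      Near (rot (dr u) (snake X (rk u))) (rot (dr v) (snake X (rk v))) ∧ u ≠ v := by
    intro u v
    have e1 := h1 u
    have e2 := h2 u
    have e3 := h1 v
    have e4 := h2 v
    rw [Ne, Subtype.ext_iff, Prod.ext_iff]
    simp only [Pattern.graph, SimpleGraph.comap_adj, gridGraph, Near]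
    omega
  refine isTree_of_parent _ (f 0 (0, 1)) (fun v => f (rk v - 1) (dr v)) rk ?_ ?_
  · intro v hv
    have h0 := hroot v hv
    have hl := hrk v
    have hr := hfr (rk v - 1) (dr v) (by omega) (hdr v)
    refine ⟨?_, by rw [hr]; omega⟩
    rw [hadj]
    constructor
    · have h3 := hf (rk v - 1) (dr v) (by omega) (hdr v)
      have h4 := h1 (f (rk v - 1) (dr v))
      have h5 := h2 (f (rk v - 1) (dr v))
      have : rot (dr (f (rk v - 1) (dr v))) (snake X (rk (f (rk v - 1) (dr v)))) =
        rot (dr v) (snake X (rk v - 1)) := Prod.ext (by omega) (by omega)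
      rw [this, rot_near_iff (hdr v), snake_near_iff]
      omega
    · intro he
      rw [← he] at hr
      omega
  · have key : ∀ u v, rk v ≤ rk u → (snakePattern t X hX).graph.Adj u v →
        u ≠ f 0 (0, 1) ∧ v = f (rk u - 1) (dr u) := by
      intro u v hle ha
      obtain ⟨hn, hne⟩ := (hadj u v).1 ha
      have hu := hrk u
      have hlt : rk v < rk u := by
        refine hle.lt_of_ne fun he => hne ?_
        rw [hext (rk v) (dr v) u (by omega) (hdr v), ← hext (rk v) (dr v) v (by omega) (hdr v) rfl]
        rw [he] at hn ⊢
        by_cases hd : dr u = dr v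
        · rw [hd]
        · have := arm_near (hdr u) (hdr v) hd hn
          rw [show rk u = 0 by omega]
          exact hhub _ _
      refine ⟨?_, ?_⟩
      · rintro rfl
        rw [hfr 0 (0, 1) (by omega) hup] at hlt
        omega
      · refine hext _ _ _ (by omega) (hdr u) ?_
        by_cases hd : dr u = dr v
        · rw [hd, rot_near_iff (hdr v), snake_near_iff] at hn
          rw [hd, show rk u - 1 = rk v by omega]
        · have := arm_near (hdr u) (hdr v) hd hn
          rw [show rk u - 1 = 0 by omega, show rk v = 0 by omega]
          exact hhub _ _
    intro u v ha
    rcases le_total (rk v) (rk u) with h | h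
    · exact .inl (key u v h ha)
    · exact .inr (key v u h ha.symm)

/-! ### Central exits and their stability under refinement -/

/-- The width of `P` is `2 * h + 1`, and the white squares along the sides of `P` are the four
central ones. -/
structure Pattern.HasCentralExits (P : Pattern) (h : ℕ) : Prop where
  width_eq : P.width = 2 * h + 1
  fst_border : ∀ q ∈ P.white, q.1 = 0 ∨ q.1 = 2 * h → q.2 = h
  snd_border : ∀ q ∈ P.white, q.2 = 0 ∨ q.2 = 2 * h → q.1 = h
  left_mem : (0, h) ∈ P.white
  right_mem : (2 * h, h) ∈ P.white
  bottom_mem : (h, 0) ∈ P.white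
  top_mem : (h, 2 * h) ∈ P.white

namespace Pattern.HasCentralExits

variable {P Q : Pattern} {h k : ℕ}

theorem lt_width {P : Pattern} {q : ℕ × ℕ} (hq : q ∈ P.white) : q.1 < P.width ∧ q.2 < P.width := by
  simpa using P.white_subset hq

theorem mem_refine {x r q : ℕ × ℕ} (hx : x ∈ P.white) (hr : r ∈ Q.white)
    (h1 : q.1 = Q.width * x.1 + r.1) (h2 : q.2 = Q.width * x.2 + r.2) :
    q ∈ (P.refine Q).white :=
  Finset.mem_image.2 ⟨(x, r), Finset.mem_product.2 ⟨hx, hr⟩, Prod.ext h1.symm h2.symm⟩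

/-- A refined square is on a side only if both its coarse square and its position inside it are on
that side. Both are then central, and so is the refined square. -/
theorem refine (hP : P.HasCentralExits h) (hQ : Q.HasCentralExits k) :
    (P.refine Q).HasCentralExits ((2 * k + 1) * h + k) := by
  have aux : ∀ a b, a ≤ 2 * h → b ≤ 2 * k →
      ((2 * k + 1) * a + b = 0 ∨ (2 * k + 1) * a + b = 2 * ((2 * k + 1) * h + k)) →
      (a = 0 ∧ b = 0 ∨ a = 2 * h ∧ b = 2 * k) := by
    intro a b ha hb hab
    rcases hab with hab | hab
    · left
      have : (2 * k + 1) * a = 0 := by omega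
      simp only [mul_eq_zero] at this
      omega
    · right
      rcases ha.eq_or_lt with rfl | ha
      · refine ⟨rfl, ?_⟩
        linarith
      · have := Nat.mul_le_mul_left (2 * k + 1) (show a + 1 ≤ 2 * h from ha)
        nlinarith
  constructor
  · rw [show (P.refine Q).width = P.width * Q.width from rfl, hP.width_eq, hQ.width_eq]
    ring
  · intro q hq hq'
    obtain ⟨⟨x, r⟩, hx, rfl⟩ := Finset.mem_image.1 hq
    obtain ⟨hx, hr⟩ := Finset.mem_product.1 hx
    have w1 := lt_width hx
    have w2 := lt_width hr
    simp only [hP.width_eq] at w1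
    simp only [hQ.width_eq] at w2 hq' ⊢
    rcases aux _ _ (by omega) (by omega) hq' with ⟨h1, h2⟩ | ⟨h1, h2⟩
    · rw [hP.fst_border x hx (.inl h1), hQ.fst_border r hr (.inl h2)]
    · rw [hP.fst_border x hx (.inr h1), hQ.fst_border r hr (.inr h2)]
  · intro q hq hq'
    obtain ⟨⟨x, r⟩, hx, rfl⟩ := Finset.mem_image.1 hq
    obtain ⟨hx, hr⟩ := Finset.mem_product.1 hx
    have w1 := lt_width hx
    have w2 := lt_width hr
    simp only [hP.width_eq] at w1
    simp only [hQ.width_eq] at w2 hq' ⊢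
    rcases aux _ _ (by omega) (by omega) hq' with ⟨h1, h2⟩ | ⟨h1, h2⟩
    · rw [hP.snd_border x hx (.inl h1), hQ.snd_border r hr (.inl h2)]
    · rw [hP.snd_border x hx (.inr h1), hQ.snd_border r hr (.inr h2)]
  · exact mem_refine hP.left_mem hQ.left_mem (by simp) (by simp [hQ.width_eq])
  · exact mem_refine hP.right_mem hQ.right_mem (by simp only [hQ.width_eq]; ring)
      (by simp [hQ.width_eq])
  · exact mem_refine hP.bottom_mem hQ.bottom_mem (by simp [hQ.width_eq]) (by simp)
  · exact mem_refine hP.top_mem hQ.top_mem (by simp [hQ.width_eq])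
      (by simp only [hQ.width_eq]; ring)

/-- The central square of the row or column along a side. -/
def _root_.Labyrinth.Side.exitSquare (h : ℕ) : Side → ℕ × ℕ
  | .top => (h, 2 * h)
  | .bottom => (h, 0)
  | .left => (0, h)
  | .right => (2 * h, h)

theorem isExit_iff (hP : P.HasCentralExits h) (s : Side) (q : ℕ × ℕ) :
    P.IsExit s q ↔ q = s.exitSquare h := by
  have e : P.width - 1 = 2 * h := by rw [hP.width_eq]; omega
  cases s <;> simp only [IsExit, Side.exitSquare, Prod.ext_iff, e]
  · constructor
    · rintro ⟨h1, h2, -⟩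
      exact ⟨hP.snd_border q h1 (.inr h2), h2⟩
    · rintro ⟨h1, h2⟩
      rw [h1, show q = (h, 2 * h) from Prod.ext h1 h2]
      exact ⟨hP.top_mem, rfl, hP.bottom_mem⟩
  · constructor
    · rintro ⟨h1, h2, -⟩
      exact ⟨hP.snd_border q h1 (.inl h2), h2⟩
    · rintro ⟨h1, h2⟩
      rw [h1, show q = (h, 0) from Prod.ext h1 h2]
      exact ⟨hP.bottom_mem, rfl, hP.top_mem⟩
  · constructor
    · rintro ⟨h1, h2, -⟩
      exact ⟨h2, hP.fst_border q h1 (.inl h2)⟩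
    · rintro ⟨h1, h2⟩
      rw [h2, show q = (0, h) from Prod.ext h1 h2]
      exact ⟨hP.left_mem, rfl, hP.right_mem⟩
  · constructor
    · rintro ⟨h1, h2, -⟩
      exact ⟨h2, hP.fst_border q h1 (.inr h2)⟩
    · rintro ⟨h1, h2⟩
      rw [h2, show q = (2 * h, h) from Prod.ext h1 h2]
      exact ⟨hP.right_mem, rfl, hP.left_mem⟩

theorem isLabyrinth (hP : P.HasCentralExits h) (hh : 1 ≤ h) (ht : P.graph.IsTree) :
    P.IsLabyrinth := by
  have e : P.width - 1 = 2 * h := by rw [hP.width_eq]; omega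
  refine ⟨by rw [hP.width_eq]; omega, ht, ?_, ?_, ?_⟩ <;> rw [e]
  · exact ⟨h, ⟨hP.top_mem, hP.bottom_mem⟩, fun i hi => hP.snd_border _ hi.2 (.inl rfl)⟩
  · exact ⟨h, ⟨hP.left_mem, hP.right_mem⟩, fun i hi => hP.fst_border _ hi.1 (.inl rfl)⟩
  · constructor
    · rintro ⟨h1, -⟩
      have := hP.fst_border _ h1 (.inl rfl)
      simp only at this
      omega
    · rintro ⟨h1, -⟩
      have := hP.fst_border _ h1 (.inl rfl)
      simp only at this
      omega

end Pattern.HasCentralExits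

theorem snakePattern_hasCentralExits (t X : ℕ) (hX : X ≤ 4 * t) :
    (snakePattern t X hX).HasCentralExits (4 * t + 1) := by
  have key : ∀ q : ℕ × ℕ, ∀ d, IsDir d → (q.1 : ℤ) = (4 * t + 1) * d.1 + (4 * t + 1) →
      (q.2 : ℤ) = (4 * t + 1) * d.2 + (4 * t + 1) → q ∈ (snakePattern t X hX).white := by
    intro q d hd h1 h2
    refine mem_white_snakePattern.2 ⟨_, le_rfl, d, hd, ?_, ?_⟩
    · rw [h1]; simp [snake_armLength, rot]
    · rw [h2]; simp [snake_armLength, rot]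
  have hb : ∀ q ∈ (snakePattern t X hX).white, (0 < q.1 ∧ q.1 < 2 * (4 * t + 1) ∧ 0 < q.2 ∧
      q.2 < 2 * (4 * t + 1)) ∨ (q.1 = 4 * t + 1 ∧ (q.2 = 0 ∨ q.2 = 2 * (4 * t + 1))) ∨
      (q.2 = 4 * t + 1 ∧ (q.1 = 0 ∨ q.1 = 2 * (4 * t + 1))) := by
    intro q hq
    obtain ⟨n, hn, d, hd, h1, h2⟩ := mem_white_snakePattern.1 hq
    rcases arm_cases hX hd hn with h | ⟨-, h, h'⟩
    · omega
    · rw [h] at h1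
      rw [h'] at h2
      rcases hd with ⟨h3, h4⟩ | ⟨h3, h4⟩ | ⟨h3, h4⟩ | ⟨h3, h4⟩ <;> rw [h3] at h1 <;>
        rw [h4] at h2 <;> omega
  constructor
  · simp only [snakePattern]; omega
  · intro q hq; have := hb q hq; omega
  · intro q hq; have := hb q hq; omega
  · exact key _ (-1, 0) (by simp [IsDir]) (by simp) (by simp)
  · exact key _ (1, 0) (by simp [IsDir]) (by push_cast; ring) (by simp)
  · exact key _ (0, -1) (by simp [IsDir]) (by simp) (by simp)
  · exact key _ (0, 1) (by simp [IsDir]) (by simp) (by push_cast; ring)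

theorem snakePattern_isLabyrinth (t X : ℕ) (hX : X ≤ 4 * t) :
    (snakePattern t X hX).IsLabyrinth :=
  (snakePattern_hasCentralExits t X hX).isLabyrinth (by omega) (snakePattern_isTree t X hX)

/-! ### The walks of all levels and their ends -/

theorem refineWalk_first (t X : ℕ) (P : ℤ → ℤ × ℤ) (j : ℤ) :
    refineWalk t X P (pathLength t X * j) =
      ((8 * t + 3) * (P j).1 + (4 * t + 1) * ((P (j - 1)).1 - (P j).1),
        (8 * t + 3) * (P j).2 + (4 * t + 1) * ((P (j - 1)).2 - (P j).2)) := by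
  have := refineWalk_apply t X P j (pathLength_pos t X)
  rw [Nat.cast_zero, add_zero] at this
  rw [this, pathCell_zero]
  simp

theorem refineWalk_last (t X : ℕ) (P : ℤ → ℤ × ℤ) (j : ℤ) :
    refineWalk t X P (pathLength t X * j - 1) =
      ((8 * t + 3) * (P (j - 1)).1 + (4 * t + 1) * ((P j).1 - (P (j - 1)).1),
        (8 * t + 3) * (P (j - 1)).2 + (4 * t + 1) * ((P j).2 - (P (j - 1)).2)) := by
  have := refineWalk_apply t X P (j - 1) (i := 2 * armLength t X) (by simp [pathLength])
  rw [pathCell_last, sub_add_cancel] at this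
  have e : (pathLength t X * (j - 1) + (2 * armLength t X : ℕ) : ℤ) = pathLength t X * j - 1 := by
    rw [pathLength]; push_cast; ring
  rw [e] at this
  rw [this]
  simp

theorem exists_white_pathCell {t X : ℕ} (hX : X ≤ 4 * t) {d d' : ℤ × ℤ} (hd : IsDir d)
    (hd' : IsDir d') {i : ℕ} (hi : i < pathLength t X) :
    ∃ r ∈ (snakePattern t X hX).white, (r.1 : ℤ) = (pathCell t X d d' i).1 + (4 * t + 1) ∧
      (r.2 : ℤ) = (pathCell t X d d' i).2 + (4 * t + 1) := by
  have key : ∀ n ≤ armLength t X, ∀ d, IsDir d → ∃ r ∈ (snakePattern t X hX).white,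
      (r.1 : ℤ) = (rot d (snake X n)).1 + (4 * t + 1) ∧
      (r.2 : ℤ) = (rot d (snake X n)).2 + (4 * t + 1) := by
    intro n hn d hd
    have hb := arm_bounds hX hd hn
    refine ⟨(((rot d (snake X n)).1 + (4 * t + 1)).toNat,
        ((rot d (snake X n)).2 + (4 * t + 1)).toNat), mem_white_snakePattern.2
          ⟨n, hn, d, hd, ?_, ?_⟩, ?_, ?_⟩ <;> simp only <;> omega
  unfold pathCell
  unfold pathLength at hi
  split_ifs with h
  · exact key _ (by omega) d hd
  · exact key _ (by omega) d' hd'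

/-- The path that runs straight from the side `d` of a square to its centre and then straight
through the side `d'`. -/
def baseWalk (d d' : ℤ × ℤ) (j : ℤ) : ℤ × ℤ :=
  if j ≤ 0 then (-j * d.1, -j * d.2) else (j * d'.1, j * d'.2)

theorem goodWalk_baseWalk {d d' : ℤ × ℤ} (hd : IsDir d) (hd' : IsDir d') (hne : d ≠ d') :
    GoodWalk (baseWalk d d') := by
  intro j j'
  rw [Ne, Prod.ext_iff] at hne
  unfold baseWalk Near
  rcases hd with ⟨h1, h2⟩ | ⟨h1, h2⟩ | ⟨h1, h2⟩ | ⟨h1, h2⟩ <;>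
  rcases hd' with ⟨h3, h4⟩ | ⟨h3, h4⟩ | ⟨h3, h4⟩ | ⟨h3, h4⟩ <;>
  simp only [h1, h2, h3, h4, and_self, not_true] at hne ⊢ <;> split_ifs <;> simp only <;> omega

/-- The product of the widths of the first `n` patterns. -/
def gridWidth (t : ℕ → ℕ) (n : ℕ) : ℕ := ∏ k ∈ Finset.range n, (8 * t k + 3)

/-- The number of squares of the paths at level `n`. -/
def walkLength (t X : ℕ → ℕ) (n : ℕ) : ℕ := ∏ k ∈ Finset.range n, pathLength (t k) (X k)

theorem gridWidth_succ (t : ℕ → ℕ) (n : ℕ) :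
    gridWidth t (n + 1) = gridWidth t n * (8 * t n + 3) := Finset.prod_range_succ _ _

theorem walkLength_succ (t X : ℕ → ℕ) (n : ℕ) :
    walkLength t X (n + 1) = walkLength t X n * pathLength (t n) (X n) :=
  Finset.prod_range_succ _ _

theorem pow_le_gridWidth (t : ℕ → ℕ) (n : ℕ) : 3 ^ n ≤ gridWidth t n := by
  induction n with
  | zero => simp [gridWidth]
  | succ n ih => rw [gridWidth_succ, pow_succ]; exact Nat.mul_le_mul ih (by omega)

theorem pow_le_walkLength (t X : ℕ → ℕ) (n : ℕ) : 3 ^ n ≤ walkLength t X n := by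
  induction n with
  | zero => simp [walkLength]
  | succ n ih =>
    rw [walkLength_succ, pow_succ]
    exact Nat.mul_le_mul ih (by unfold pathLength armLength; omega)

theorem gridWidth_pos (t : ℕ → ℕ) (n : ℕ) : 0 < gridWidth t n :=
  (Nat.pow_pos (by norm_num)).trans_le (pow_le_gridWidth t n)

theorem walkLength_pos (t X : ℕ → ℕ) (n : ℕ) : 0 < walkLength t X n :=
  (Nat.pow_pos (by norm_num)).trans_le (pow_le_walkLength t X n)

theorem exists_lt_gridWidth (t : ℕ → ℕ) (c : ℝ) : ∃ n, c < gridWidth t n := by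
  obtain ⟨n, hn⟩ := pow_unbounded_of_one_lt c (show (1 : ℝ) < 3 by norm_num)
  exact ⟨n, hn.trans_le (by exact_mod_cast pow_le_gridWidth t n)⟩

theorem exists_lt_walkLength (t X : ℕ → ℕ) (c : ℝ) : ∃ n, c < walkLength t X n := by
  obtain ⟨n, hn⟩ := pow_unbounded_of_one_lt c (show (1 : ℝ) < 3 by norm_num)
  exact ⟨n, hn.trans_le (by exact_mod_cast pow_le_walkLength t X n)⟩

/-- The path of level `n` from the side `d` to the side `d'`. -/
def walk (t X : ℕ → ℕ) (d d' : ℤ × ℤ) : ℕ → ℤ → ℤ × ℤ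
  | 0 => baseWalk d d'
  | n + 1 => refineWalk (t n) (X n) (walk t X d d' n)

section walk

variable {t X : ℕ → ℕ} {d d' : ℤ × ℤ}

theorem goodWalk_walk (hX : ∀ k, X k ≤ 4 * t k) (hd : IsDir d) (hd' : IsDir d') (hne : d ≠ d')
    (n : ℕ) : GoodWalk (walk t X d d' n) := by
  induction n with
  | zero => exact goodWalk_baseWalk hd hd' hne
  | succ n ih => exact ih.refineWalk (hX n)

/-- The squares `0` and `-1` lie on either side of the midpoint of the side `d`. Both are tracked
because the first refined square depends on the predecessor; the factor `2` avoids halving. -/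
theorem walk_start (n : ℕ) :
    2 * (walk t X d d' n 0).1 = (gridWidth t n - 1) * d.1 ∧
    2 * (walk t X d d' n 0).2 = (gridWidth t n - 1) * d.2 ∧
    2 * (walk t X d d' n (-1)).1 = (gridWidth t n + 1) * d.1 ∧
    2 * (walk t X d d' n (-1)).2 = (gridWidth t n + 1) * d.2 := by
  induction n with
  | zero => simp [walk, baseWalk, gridWidth]
  | succ n ih =>
    have h1 := refineWalk_first (t n) (X n) (walk t X d d' n) 0
    have h2 := refineWalk_last (t n) (X n) (walk t X d d' n) 0
    rw [mul_zero, zero_sub] at h1 h2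
    simp only [walk, h1, h2, gridWidth_succ]
    push_cast
    obtain ⟨i1, i2, i3, i4⟩ := ih
    refine ⟨?_, ?_, ?_, ?_⟩
    · linear_combination (4 * (t n : ℤ) + 2) * i1 + (4 * (t n : ℤ) + 1) * i3
    · linear_combination (4 * (t n : ℤ) + 2) * i2 + (4 * (t n : ℤ) + 1) * i4
    · linear_combination (4 * (t n : ℤ) + 2) * i3 + (4 * (t n : ℤ) + 1) * i1
    · linear_combination (4 * (t n : ℤ) + 2) * i4 + (4 * (t n : ℤ) + 1) * i2

theorem walk_end (n : ℕ) :
    2 * (walk t X d d' n (walkLength t X n - 1)).1 = (gridWidth t n - 1) * d'.1 ∧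
    2 * (walk t X d d' n (walkLength t X n - 1)).2 = (gridWidth t n - 1) * d'.2 ∧
    2 * (walk t X d d' n (walkLength t X n)).1 = (gridWidth t n + 1) * d'.1 ∧
    2 * (walk t X d d' n (walkLength t X n)).2 = (gridWidth t n + 1) * d'.2 := by
  induction n with
  | zero => simp [walk, baseWalk, gridWidth, walkLength]
  | succ n ih =>
    have h1 := refineWalk_first (t n) (X n) (walk t X d d' n) (walkLength t X n)
    have h2 := refineWalk_last (t n) (X n) (walk t X d d' n) (walkLength t X n)
    have e : ((walkLength t X (n + 1) : ℕ) : ℤ) = pathLength (t n) (X n) * walkLength t X n := by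
      rw [walkLength_succ]; push_cast; ring
    rw [e]
    simp only [walk, h1, h2, gridWidth_succ]
    push_cast
    obtain ⟨i1, i2, i3, i4⟩ := ih
    refine ⟨?_, ?_, ?_, ?_⟩
    · linear_combination (4 * (t n : ℤ) + 2) * i1 + (4 * (t n : ℤ) + 1) * i3
    · linear_combination (4 * (t n : ℤ) + 2) * i2 + (4 * (t n : ℤ) + 1) * i4
    · linear_combination (4 * (t n : ℤ) + 2) * i3 + (4 * (t n : ℤ) + 1) * i1
    · linear_combination (4 * (t n : ℤ) + 2) * i4 + (4 * (t n : ℤ) + 1) * i2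

end walk

/-! ### Grid squares in the plane -/

/-- The closed square with the index `p` in the grid of width `1 / M` that is centred at the
centre of the unit square. -/
def cell (M : ℕ) (p : ℤ × ℤ) : Set Plane :=
  {z | |(M : ℝ) * (z 0 - 1 / 2) - p.1| ≤ 1 / 2 ∧ |(M : ℝ) * (z 1 - 1 / 2) - p.2| ≤ 1 / 2}

theorem square_eq_cell {M : ℕ} (hM : 0 < M) {q : ℕ × ℕ} {p : ℤ × ℤ}
    (h1 : 2 * (q.1 : ℤ) + 1 = 2 * p.1 + M) (h2 : 2 * (q.2 : ℤ) + 1 = 2 * p.2 + M) :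
    square M q = cell M p := by
  have hM' : (0 : ℝ) < M := by exact_mod_cast hM
  have h1' : 2 * (q.1 : ℝ) + 1 = 2 * p.1 + M := by exact_mod_cast h1
  have h2' : 2 * (q.2 : ℝ) + 1 = 2 * p.2 + M := by exact_mod_cast h2
  ext z
  simp only [square, cell, Set.mem_ofPred_eq, abs_le, div_le_iff₀ hM', le_div_iff₀ hM']
  constructor
  · rintro ⟨a, b, c, d⟩
    refine ⟨⟨?_, ?_⟩, ?_, ?_⟩ <;> linarith
  · rintro ⟨⟨a, b⟩, c, d⟩
    refine ⟨?_, ?_, ?_, ?_⟩ <;> linarith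

theorem plane_dist_le (z w : Plane) : dist z w ≤ |z 0 - w 0| + |z 1 - w 1| := by
  rw [EuclideanSpace.dist_eq, Fin.sum_univ_two, Real.dist_eq, Real.dist_eq]
  refine Real.sqrt_le_iff.2 ⟨by positivity, ?_⟩
  nlinarith [abs_nonneg (z 0 - w 0), abs_nonneg (z 1 - w 1)]

theorem plane_abs_le (z w : Plane) : |z 0 - w 0| ≤ dist z w ∧ |z 1 - w 1| ≤ dist z w := by
  constructor
  · simpa [Real.dist_eq] using EuclideanSpace.dist_eq z w ▸
      Real.le_sqrt_of_sq_le (by simp [Fin.sum_univ_two, Real.dist_eq, sq_nonneg])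
  · simpa [Real.dist_eq] using EuclideanSpace.dist_eq z w ▸
      Real.le_sqrt_of_sq_le (by simp [Fin.sum_univ_two, Real.dist_eq, sq_nonneg])

/-- In each coordinate the centres differ by at most `1 / M`, and two half-widths add another `1 /
M`; summing both coordinates gives `4 / M`. -/
theorem dist_le_of_near {M : ℕ} (hM : 0 < M) {p q : ℤ × ℤ} (h : Near p q) {z w : Plane}
    (hz : z ∈ cell M p) (hw : w ∈ cell M q) : dist z w ≤ 4 / M := by
  have hM' : (0 : ℝ) < M := by exact_mod_cast hM
  have h' : -(1 : ℤ) ≤ p.1 - q.1 ∧ p.1 - q.1 ≤ 1 ∧ -1 ≤ p.2 - q.2 ∧ p.2 - q.2 ≤ 1 := by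
    unfold Near at h; omega
  have h1 : -(1 : ℝ) ≤ p.1 - q.1 := by exact_mod_cast h'.1
  have h2 : (p.1 : ℝ) - q.1 ≤ 1 := by exact_mod_cast h'.2.1
  have h3 : -(1 : ℝ) ≤ p.2 - q.2 := by exact_mod_cast h'.2.2.1
  have h4 : (p.2 : ℝ) - q.2 ≤ 1 := by exact_mod_cast h'.2.2.2
  obtain ⟨z1, z2⟩ := hz
  obtain ⟨w1, w2⟩ := hw
  rw [abs_le] at z1 z2 w1 w2
  have e1 : |z 0 - w 0| ≤ 2 / M := by
    rw [le_div_iff₀ hM', ← abs_of_pos hM', ← abs_mul, abs_le]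
    constructor <;> linarith
  have e2 : |z 1 - w 1| ≤ 2 / M := by
    rw [le_div_iff₀ hM', ← abs_of_pos hM', ← abs_mul, abs_le]
    constructor <;> linarith
  calc dist z w ≤ 2 / M + 2 / M := (plane_dist_le z w).trans (add_le_add e1 e2)
    _ = 4 / M := by ring

theorem not_mem_cell_of_apart {M : ℕ} {p q : ℤ × ℤ} (h : Apart p q) {z : Plane}
    (hz : z ∈ cell M p) (hw : z ∈ cell M q) : False := by
  obtain ⟨z1, z2⟩ := hz
  obtain ⟨w1, w2⟩ := hw
  rw [abs_le] at z1 z2 w1 w2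
  rcases h with h | h | h | h
  · have : (p.1 : ℝ) + 2 ≤ q.1 := by exact_mod_cast h
    linarith
  · have : (q.1 : ℝ) + 2 ≤ p.1 := by exact_mod_cast h
    linarith
  · have : (p.2 : ℝ) + 2 ≤ q.2 := by exact_mod_cast h
    linarith
  · have : (q.2 : ℝ) + 2 ≤ p.2 := by exact_mod_cast h
    linarith

theorem eq_of_mem_cell {t : ℕ → ℕ} {p : ℕ → ℤ × ℤ} {z w : Plane}
    (hz : ∀ n, z ∈ cell (gridWidth t n) (p n)) (hw : ∀ n, w ∈ cell (gridWidth t n) (p n)) :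
    z = w := by
  by_contra hne
  have hpos := dist_pos.2 hne
  obtain ⟨n, hn⟩ := exists_lt_gridWidth t (4 / dist z w)
  have h1 := dist_le_of_near (gridWidth_pos t n) (show Near (p n) (p n) by simp [Near])
    (hz n) (hw n)
  have hM : (0 : ℝ) < gridWidth t n := by exact_mod_cast gridWidth_pos t n
  rw [le_div_iff₀ hM] at h1
  rw [div_lt_iff₀ hpos] at hn
  linarith

/-- The hypothesis says that the intervals of centre `p n / M` and length `1 / M`, with `M` the grid
width of level `n`, are nested, since `4 * t n + 1 + 1 / 2` is half of `8 * t n + 3`. -/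
theorem exists_real_of_nested {t : ℕ → ℕ} {p : ℕ → ℤ}
    (h : ∀ n, |p (n + 1) - (8 * t n + 3) * p n| ≤ 4 * t n + 1) :
    ∃ x : ℝ, ∀ n, |gridWidth t n * (x - 1 / 2) - p n| ≤ 1 / 2 := by
  have hM : ∀ n, (0 : ℝ) < gridWidth t n := fun n => by exact_mod_cast gridWidth_pos t n
  have hanti : Antitone fun n => Set.Icc (((p n : ℝ) - 1 / 2) / gridWidth t n)
      (((p n : ℝ) + 1 / 2) / gridWidth t n) := by
    refine antitone_nat_of_succ_le fun n => Set.Icc_subset_Icc ?_ ?_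
    all_goals
      have h1 := abs_le.1 (h n)
      have h2 : -(4 * t n + 1 : ℝ) ≤ p (n + 1) - (8 * t n + 3) * p n := by exact_mod_cast h1.1
      have h3 : (p (n + 1) : ℝ) - (8 * t n + 3) * p n ≤ 4 * t n + 1 := by exact_mod_cast h1.2
      rw [div_le_div_iff₀ (hM _) (hM _), gridWidth_succ]
      push_cast
      nlinarith [hM n]
  refine ⟨(⨆ n, ((p n : ℝ) - 1 / 2) / gridWidth t n) + 1 / 2, fun n => ?_⟩
  have h1 := ciSup_mem_iInter_Icc_of_antitone_Icc hanti (fun n => by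
    have := hM n
    gcongr
    linarith)
  have h2 := Set.mem_iInter.1 h1 n
  rw [Set.mem_Icc, div_le_iff₀ (hM n), le_div_iff₀ (hM n)] at h2
  rw [abs_le]
  constructor <;> linarith

theorem exists_floor_eq {L : ℕ} (hL : 0 < L) (y : ℝ) :
    ∃ i < L, ⌊(L : ℝ) * y⌋ = L * ⌊y⌋ + (i : ℕ) := by
  obtain ⟨j, i, hi, h⟩ := exists_eq_mul_add L hL ⌊(L : ℝ) * y⌋
  refine ⟨i, hi, ?_⟩
  have hL' : (0 : ℝ) < L := by exact_mod_cast hL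
  have hi' : (i : ℝ) + 1 ≤ L := by exact_mod_cast hi
  have hj : ⌊y⌋ = j := by
    rw [Int.floor_eq_iff] at h ⊢
    push_cast at h
    constructor
    · refine le_of_mul_le_mul_left ?_ hL'
      linarith [(Nat.cast_nonneg i : (0 : ℝ) ≤ i)]
    · refine lt_of_mul_lt_mul_left ?_ hL'.le
      linarith
  rw [hj, h]

/-! ### The limit curve: existence, continuity, injectivity, end points -/

section curve

variable {t X : ℕ → ℕ} {d d' : ℤ × ℤ}

theorem floor_walkLength_succ (t X : ℕ → ℕ) (n : ℕ) (x : ℝ) :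
    ∃ i < pathLength (t n) (X n), ⌊(walkLength t X (n + 1) : ℝ) * x⌋ =
      pathLength (t n) (X n) * ⌊(walkLength t X n : ℝ) * x⌋ + (i : ℕ) := by
  have := exists_floor_eq (pathLength_pos (t n) (X n)) ((walkLength t X n : ℝ) * x)
  rw [← mul_assoc] at this
  rw [walkLength_succ, Nat.cast_mul, mul_comm (walkLength t X n : ℝ)]
  exact this

/-- By `floor_walkLength_succ` the index of `x` at level `n + 1` lies in the block of its index at
level `n`, so the squares are nested and have a common point. -/
theorem exists_curve (hX : ∀ k, X k ≤ 4 * t k) (hd : IsDir d) (hd' : IsDir d') (hne : d ≠ d') :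
    ∃ γ : ℝ → Plane, ∀ x n,
      γ x ∈ cell (gridWidth t n) (walk t X d d' n ⌊(walkLength t X n : ℝ) * x⌋) := by
  suffices h : ∀ x : ℝ, ∃ z, ∀ n,
      z ∈ cell (gridWidth t n) (walk t X d d' n ⌊(walkLength t X n : ℝ) * x⌋) by
    choose γ hγ using h
    exact ⟨γ, hγ⟩
  intro x
  have key : ∀ n, ∃ v : ℤ × ℤ, (|v.1| ≤ 4 * t n + 1 ∧ |v.2| ≤ 4 * t n + 1) ∧
      walk t X d d' (n + 1) ⌊(walkLength t X (n + 1) : ℝ) * x⌋ =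
      ((8 * t n + 3) * (walk t X d d' n ⌊(walkLength t X n : ℝ) * x⌋).1 + v.1,
      (8 * t n + 3) * (walk t X d d' n ⌊(walkLength t X n : ℝ) * x⌋).2 + v.2) := by
    intro n
    obtain ⟨i, hi, h⟩ := floor_walkLength_succ t X n x
    have hg := goodWalk_walk hX hd hd' hne n
    have := pathCell_bounds (hX n) (hg.isDir_prev ⌊(walkLength t X n : ℝ) * x⌋)
      (hg.isDir_next ⌊(walkLength t X n : ℝ) * x⌋) hi
    refine ⟨_, ⟨abs_le.2 ⟨this.1, this.2.1⟩, abs_le.2 this.2.2⟩, ?_⟩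
    rw [h]
    exact refineWalk_apply _ _ _ _ hi
  obtain ⟨a, ha⟩ := exists_real_of_nested (t := t)
    (p := fun n => (walk t X d d' n ⌊(walkLength t X n : ℝ) * x⌋).1) fun n => by
      obtain ⟨v, hv, h⟩ := key n
      rw [h]; simpa using hv.1
  obtain ⟨b, hb⟩ := exists_real_of_nested (t := t)
    (p := fun n => (walk t X d d' n ⌊(walkLength t X n : ℝ) * x⌋).2) fun n => by
      obtain ⟨v, hv, h⟩ := key n
      rw [h]; simpa using hv.2
  exact ⟨!₂[a, b], fun n => ⟨by simpa using ha n, by simpa using hb n⟩⟩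

variable {γ : ℝ → Plane}

theorem curve_continuous
    (hγ : ∀ x n,
      γ x ∈ cell (gridWidth t n) (walk t X d d' n ⌊(walkLength t X n : ℝ) * x⌋))
    (hX : ∀ k, X k ≤ 4 * t k) (hd : IsDir d) (hd' : IsDir d')
    (hne : d ≠ d') : Continuous γ := by
  refine Metric.continuous_iff.2 fun x ε hε => ?_
  obtain ⟨n, hn⟩ := exists_lt_gridWidth t (4 / ε)
  have hN : (0 : ℝ) < walkLength t X n := by exact_mod_cast walkLength_pos t X n
  have hM : (0 : ℝ) < gridWidth t n := by exact_mod_cast gridWidth_pos t n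
  refine ⟨1 / walkLength t X n, by positivity, fun y hy => ?_⟩
  have h1 : dist (γ y) (γ x) ≤ 4 / gridWidth t n := by
    refine dist_le_of_near (gridWidth_pos t n) ?_ (hγ y n) (hγ x n)
    rw [goodWalk_walk hX hd hd' hne n]
    rw [Real.dist_eq, lt_div_iff₀ hN, ← abs_of_pos hN, ← abs_mul, abs_lt] at hy
    generalize hN' : (walkLength t X n : ℝ) = N at *
    have a1 := Int.floor_le (N * x)
    have a2 := Int.lt_floor_add_one (N * x)
    have a3 := Int.floor_le (N * y)
    have a4 := Int.lt_floor_add_one (N * y)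
    constructor
    · have : (⌊N * y⌋ : ℝ) < ⌊N * x⌋ + 2 := by linarith
      have : ⌊N * y⌋ < ⌊N * x⌋ + 2 := by exact_mod_cast this
      omega
    · have : (⌊N * x⌋ : ℝ) < ⌊N * y⌋ + 2 := by linarith
      have : ⌊N * x⌋ < ⌊N * y⌋ + 2 := by exact_mod_cast this
      omega
  refine h1.trans_lt ?_
  rw [div_lt_iff₀ hε] at hn
  rw [div_lt_iff₀ hM]
  linarith

/-- At a level where the parameters are more than `2` indices apart the squares are not adjacent; at
the following level the closed squares are disjoint. -/
theorem curve_injective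
    (hγ : ∀ x n,
      γ x ∈ cell (gridWidth t n) (walk t X d d' n ⌊(walkLength t X n : ℝ) * x⌋))
    (hX : ∀ k, X k ≤ 4 * t k) (hd : IsDir d) (hd' : IsDir d')
    (hne : d ≠ d') : Function.Injective γ := by
  have key : ∀ x y, x < y → γ x ≠ γ y := by
    intro x y hxy he
    obtain ⟨n, hn⟩ := exists_lt_walkLength t X (2 / (y - x))
    rw [div_lt_iff₀ (sub_pos.2 hxy)] at hn
    obtain ⟨i, hi, h⟩ := floor_walkLength_succ t X n x
    obtain ⟨i', hi', h'⟩ := floor_walkLength_succ t X n y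
    have hfl : ⌊(walkLength t X n : ℝ) * x⌋ + 2 ≤ ⌊(walkLength t X n : ℝ) * y⌋ := by
      rw [Int.le_floor]
      push_cast
      linarith [Int.floor_le ((walkLength t X n : ℝ) * x)]
    have h1 := hγ x (n + 1)
    have h2 := hγ y (n + 1)
    rw [h] at h1
    rw [h'] at h2
    rw [he] at h1
    exact not_mem_cell_of_apart
      ((goodWalk_walk hX hd hd' hne n).apart_refineWalk (hX n) hi hi' (.inl hfl)) h1 h2
  intro x y he
  by_contra hne
  rcases lt_or_gt_of_ne hne with h | h
  · exact key x y h he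
  · exact key y x h he.symm

/-- The middle of the side `d` of the unit square. -/
noncomputable def sideMidpoint (d : ℤ × ℤ) : Plane := !₂[1 / 2 + d.1 / 2, 1 / 2 + d.2 / 2]

theorem sideMidpoint_mem_cell {M : ℕ} {d p : ℤ × ℤ} (hd : IsDir d)
    (h : 2 * p.1 = (M - 1) * d.1 ∧ 2 * p.2 = (M - 1) * d.2 ∨
      2 * p.1 = (M + 1) * d.1 ∧ 2 * p.2 = (M + 1) * d.2) : sideMidpoint d ∈ cell M p := by
  have h' : 2 * (p.1 : ℝ) = (M - 1) * d.1 ∧ 2 * (p.2 : ℝ) = (M - 1) * d.2 ∨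
      2 * (p.1 : ℝ) = (M + 1) * d.1 ∧ 2 * (p.2 : ℝ) = (M + 1) * d.2 := by exact_mod_cast h
  have hd' : -(1 : ℝ) ≤ d.1 ∧ (d.1 : ℝ) ≤ 1 ∧ -(1 : ℝ) ≤ d.2 ∧ (d.2 : ℝ) ≤ 1 := by
    have : -1 ≤ d.1 ∧ d.1 ≤ 1 ∧ -1 ≤ d.2 ∧ d.2 ≤ 1 := by unfold IsDir at hd; omega
    exact_mod_cast this
  simp only [sideMidpoint, cell, Set.mem_ofPred_eq, abs_le]
  simp
  rcases h' with ⟨h1, h2⟩ | ⟨h1, h2⟩ <;> refine ⟨⟨?_, ?_⟩, ?_, ?_⟩ <;> linarith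

theorem curve_zero
    (hγ : ∀ x n,
      γ x ∈ cell (gridWidth t n) (walk t X d d' n ⌊(walkLength t X n : ℝ) * x⌋))
    (hd : IsDir d) : γ 0 = sideMidpoint d := by
  refine eq_of_mem_cell (fun n => hγ 0 n) fun n => ?_
  rw [mul_zero, Int.floor_zero]
  have := walk_start (t := t) (X := X) (d := d) (d' := d') n
  exact sideMidpoint_mem_cell hd (.inl ⟨this.1, this.2.1⟩)

theorem curve_one
    (hγ : ∀ x n,
      γ x ∈ cell (gridWidth t n) (walk t X d d' n ⌊(walkLength t X n : ℝ) * x⌋))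
    (hd' : IsDir d') : γ 1 = sideMidpoint d' := by
  refine eq_of_mem_cell (fun n => hγ 1 n) fun n => ?_
  rw [mul_one, Int.floor_natCast]
  have := walk_end (t := t) (X := X) (d := d) (d' := d') n
  -- The parameter `1` has index `walkLength t X n`, the first square beyond the unit square; the
  -- midpoint lies on its border.
  exact sideMidpoint_mem_cell hd' (.inr this.2.2)

end curve

/-! ### The exits of the fractal, and the curve inside the fractal -/

/-- The unit vector that points to a side. -/
def Side.dir : Side → ℤ × ℤ
  | .top => (0, 1)
  | .bottom => (0, -1)
  | .left => (-1, 0)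
  | .right => (1, 0)

theorem Side.isDir_dir (s : Side) : IsDir s.dir := by cases s <;> simp [IsDir, Side.dir]

theorem Side.dir_injective : Function.Injective Side.dir := by
  intro s s' h
  cases s <;> cases s' <;> simp_all [Side.dir]

theorem Side.exitSquare_eq (s : Side) (h : ℕ) :
    ((s.exitSquare h).1 : ℤ) = h * s.dir.1 + h ∧ ((s.exitSquare h).2 : ℤ) = h * s.dir.2 + h := by
  cases s <;> simp [Side.dir, Side.exitSquare] <;> ring

theorem isClosed_square (m : ℕ) (q : ℕ × ℕ) : IsClosed (square m q) := by
  have h0 : Continuous fun p : Plane => p 0 := by fun_prop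
  have h1 : Continuous fun p : Plane => p 1 := by fun_prop
  exact (isClosed_le continuous_const h0).inter ((isClosed_le h0 continuous_const).inter
    ((isClosed_le continuous_const h1).inter (isClosed_le h1 continuous_const)))

theorem isClosed_limitSet (A : ℕ → Pattern) : IsClosed (limitSet A) :=
  isClosed_iInter fun n => (level A n).white.finite_toSet.isClosed_biUnion
    fun q _ => isClosed_square _ q

section family

variable {t X : ℕ → ℕ} (hX : ∀ k, X k ≤ 4 * t k)

theorem level_hasCentralExits (n : ℕ) : ∃ h, 2 * h + 1 = gridWidth t (n + 1) ∧
    (level (fun k => snakePattern (t k) (X k) (hX k)) n).HasCentralExits h := by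
  induction n with
  | zero =>
    refine ⟨4 * t 0 + 1, ?_, snakePattern_hasCentralExits _ _ (hX 0)⟩
    rw [gridWidth_succ]
    simp [gridWidth]
    ring
  | succ n ih =>
    obtain ⟨h, h1, h2⟩ := ih
    refine ⟨_, ?_, h2.refine (snakePattern_hasCentralExits (t (n + 1)) (X (n + 1)) (hX _))⟩
    rw [gridWidth_succ, ← h1]
    ring

theorem level_width (n : ℕ) :
    (level (fun k => snakePattern (t k) (X k) (hX k)) n).width = gridWidth t (n + 1) := by
  obtain ⟨h, h1, h2⟩ := level_hasCentralExits hX n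
  rw [h2.width_eq, h1]

/-- Central exits leave a single candidate for the exit square at each level; these squares all
contain the midpoint of the side and shrink to it. -/
theorem isFractalExit_iff (s : Side) (x : Plane) :
    IsFractalExit (fun k => snakePattern (t k) (X k) (hX k)) s x ↔ x = sideMidpoint s.dir := by
  choose h h1 h2 using level_hasCentralExits hX
  have key : ⋂ n, square (level (fun k => snakePattern (t k) (X k) (hX k)) n).width
      (s.exitSquare (h n)) = {sideMidpoint s.dir} := by
    have hc : ∀ n, square (level (fun k => snakePattern (t k) (X k) (hX k)) n).width
        (s.exitSquare (h n)) = cell (gridWidth t (n + 1)) (h n * s.dir.1, h n * s.dir.2) := by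
      intro n
      rw [level_width hX]
      have e := s.exitSquare_eq (h n)
      refine square_eq_cell (gridWidth_pos t _) ?_ ?_ <;> rw [← h1 n] <;> push_cast
      · rw [e.1]; ring
      · rw [e.2]; ring
    have hmem : ∀ n, sideMidpoint s.dir ∈
        cell (gridWidth t (n + 1)) (h n * s.dir.1, h n * s.dir.2) := by
      intro n
      refine sideMidpoint_mem_cell s.isDir_dir (.inl ?_)
      rw [← h1 n]
      push_cast
      constructor <;> ring
    simp only [hc]
    refine Set.eq_singleton_iff_unique_mem.2 ⟨Set.mem_iInter.2 hmem, fun z hz => ?_⟩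
    rw [Set.mem_iInter] at hz
    by_contra hne
    have hpos := dist_pos.2 hne
    obtain ⟨n, hn⟩ := exists_lt_gridWidth t (4 / dist z (sideMidpoint s.dir))
    have hM : (0 : ℝ) < gridWidth t n := by exact_mod_cast gridWidth_pos t n
    have hM' : (0 : ℝ) < gridWidth t (n + 1) := by exact_mod_cast gridWidth_pos t (n + 1)
    have h3 := dist_le_of_near (gridWidth_pos t (n + 1))
      (p := (h n * s.dir.1, h n * s.dir.2)) (by simp [Near]) (hz n) (hmem n)
    have h4 : (gridWidth t n : ℝ) ≤ gridWidth t (n + 1) := by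
      rw [gridWidth_succ]
      exact_mod_cast Nat.le_mul_of_pos_right _ (by omega)
    rw [le_div_iff₀ hM'] at h3
    rw [div_lt_iff₀ hpos] at hn
    nlinarith
  constructor
  · rintro ⟨T, hT, hTx⟩
    have hT' : ∀ n, T n = s.exitSquare (h n) := fun n => ((h2 n).isExit_iff s _).1 (hT n)
    simp only [hT', key] at hTx
    exact (Set.singleton_injective hTx).symm
  · rintro rfl
    exact ⟨fun n => s.exitSquare (h n), fun n => ((h2 n).isExit_iff s _).2 rfl, key⟩

variable {d d' : ℤ × ℤ}

theorem exists_white_walk (hd : IsDir d) (hd' : IsDir d') (hne : d ≠ d') (n : ℕ) :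
    ∀ j : ℤ, 0 ≤ j → j < walkLength t X (n + 1) →
    ∃ q ∈ (level (fun k => snakePattern (t k) (X k) (hX k)) n).white,
      2 * (q.1 : ℤ) + 1 = 2 * (walk t X d d' (n + 1) j).1 + gridWidth t (n + 1) ∧
      2 * (q.2 : ℤ) + 1 = 2 * (walk t X d d' (n + 1) j).2 + gridWidth t (n + 1) := by
  induction n with
  | zero =>
    intro k h0 hk
    lift k to ℕ using h0
    have hk' : k < pathLength (t 0) (X 0) := by
      simpa [walkLength] using hk
    have hg := goodWalk_walk hX hd hd' hne 0
    obtain ⟨r, hr, h1, h2⟩ := exists_white_pathCell (hX 0) (hg.isDir_prev 0) (hg.isDir_next 0) hk'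
    have h3 := refineWalk_apply (t 0) (X 0) (walk t X d d' 0) 0 hk'
    rw [mul_zero, zero_add] at h3
    have h4 : walk t X d d' 0 0 = (0, 0) := by simp [walk, baseWalk]
    refine ⟨r, hr, ?_, ?_⟩
    · rw [show walk t X d d' (0 + 1) k = refineWalk (t 0) (X 0) (walk t X d d' 0) k from rfl, h3,
        gridWidth_succ, h1, congrArg Prod.fst h4]
      simp [gridWidth]
      ring
    · rw [show walk t X d d' (0 + 1) k = refineWalk (t 0) (X 0) (walk t X d d' 0) k from rfl, h3,
        gridWidth_succ, h2, congrArg Prod.snd h4]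
      simp [gridWidth]
      ring
  | succ n ih =>
    intro k h0 hk
    obtain ⟨j, i, hi, rfl⟩ := exists_eq_mul_add _ (pathLength_pos (t (n + 1)) (X (n + 1))) k
    rw [walkLength_succ] at hk
    have hL : (0 : ℤ) < pathLength (t (n + 1)) (X (n + 1)) := by exact_mod_cast pathLength_pos _ _
    have hj0 : 0 ≤ j := by
      by_contra! hlt
      have := mul_le_mul_of_nonneg_left (show j + 1 ≤ 0 from hlt) hL.le
      rw [mul_add] at this
      omega
    have hj : j < walkLength t X (n + 1) := by
      by_contra! hlt
      have := mul_le_mul_of_nonneg_left hlt hL.le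
      push_cast at hk
      linarith
    obtain ⟨q, hq, h1, h2⟩ := ih j hj0 hj
    have hg := goodWalk_walk hX hd hd' hne (n + 1)
    obtain ⟨r, hr, h3, h4⟩ := exists_white_pathCell (hX (n + 1)) (hg.isDir_prev j)
      (hg.isDir_next j) hi
    refine ⟨(_, _), Pattern.HasCentralExits.mem_refine hq hr rfl rfl, ?_, ?_⟩
    · rw [show walk t X d d' (n + 1 + 1) = refineWalk (t (n + 1)) (X (n + 1))
        (walk t X d d' (n + 1)) from rfl, refineWalk_apply _ _ _ _ hi, gridWidth_succ t (n + 1)]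
      simp only [snakePattern]
      push_cast
      rw [h3]
      linear_combination (8 * (t (n + 1) : ℤ) + 3) * h1
    · rw [show walk t X d d' (n + 1 + 1) = refineWalk (t (n + 1)) (X (n + 1))
        (walk t X d d' (n + 1)) from rfl, refineWalk_apply _ _ _ _ hi, gridWidth_succ t (n + 1)]
      simp only [snakePattern]
      push_cast
      rw [h4]
      linear_combination (8 * (t (n + 1) : ℤ) + 3) * h2

/-- For `0 ≤ x < 1` the index belongs to a white square. At `x = 1` it does not, so the end point is
recovered by closedness of the limit set. -/
theorem curve_image_subset {γ : ℝ → Plane} (hγ : ∀ x n,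
      γ x ∈ cell (gridWidth t n) (walk t X d d' n ⌊(walkLength t X n : ℝ) * x⌋))
    (hd : IsDir d) (hd' : IsDir d') (hne : d ≠ d') :
    γ '' Set.Icc 0 1 ⊆ limitSet (fun k => snakePattern (t k) (X k) (hX k)) := by
  rw [← closure_Ico (zero_ne_one' ℝ)]
  refine (image_closure_subset_closure_image (curve_continuous hγ hX hd hd' hne)).trans ?_
  refine closure_minimal ?_ (isClosed_limitSet _)
  rintro _ ⟨x, ⟨h0, h1⟩, rfl⟩
  refine Set.mem_iInter.2 fun n => ?_
  have hN : (0 : ℝ) < walkLength t X (n + 1) := by exact_mod_cast walkLength_pos t X (n + 1)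
  obtain ⟨q, hq, h2, h3⟩ := exists_white_walk hX hd hd' hne n
    ⌊(walkLength t X (n + 1) : ℝ) * x⌋ (Int.floor_nonneg.2 (by positivity)) (by
      rw [Int.floor_lt]; push_cast; nlinarith)
  refine Set.mem_biUnion hq ?_
  rw [level_width, square_eq_cell (gridWidth_pos t _) h2 h3]
  exact hγ x (n + 1)

end family

/-! ### Covering numbers of the arc at the grid scales -/

section covering

variable {t X : ℕ → ℕ} {d d' : ℤ × ℤ} {γ : ℝ → Plane}

theorem encard_cover_le (hγ : ∀ x n,
      γ x ∈ cell (gridWidth t n) (walk t X d d' n ⌊(walkLength t X n : ℝ) * x⌋)) (n : ℕ) :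
    Metric.externalCoveringNumber (4 / gridWidth t n : NNReal) (γ '' Set.Icc 0 1) ≤
      (walkLength t X n + 1 : ℕ) := by
  have hN : (0 : ℝ) < walkLength t X n := by exact_mod_cast walkLength_pos t X n
  let C : Finset Plane := (Finset.range (walkLength t X n + 1)).image
    fun j : ℕ => γ (j / walkLength t X n)
  have hC : Metric.IsCover (4 / gridWidth t n : NNReal) (γ '' Set.Icc 0 1) (C : Set Plane) := by
    rw [Metric.isCover_iff_subset_iUnion_closedBall]
    rintro _ ⟨x, ⟨h0, h1⟩, rfl⟩
    have hf : 0 ≤ ⌊(walkLength t X n : ℝ) * x⌋ := Int.floor_nonneg.2 (by positivity)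
    have hle : ⌊(walkLength t X n : ℝ) * x⌋ ≤ walkLength t X n := by
      have := (Int.floor_le ((walkLength t X n : ℝ) * x)).trans
        (mul_le_of_le_one_right hN.le h1)
      exact_mod_cast this
    obtain ⟨j, hj⟩ := Int.eq_ofNat_of_zero_le hf
    have hmem : γ (j / walkLength t X n) ∈ C :=
      Finset.mem_image.2 ⟨j, Finset.mem_range.2 (by omega), rfl⟩
    refine Set.mem_biUnion hmem ?_
    rw [Metric.mem_closedBall]
    have h2 := hγ (j / walkLength t X n) n
    rw [mul_div_cancel₀ _ hN.ne', Int.floor_natCast, ← hj] at h2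
    simpa using dist_le_of_near (gridWidth_pos t n) (by simp [Near]) (hγ x n) h2
  refine hC.externalCoveringNumber_le_encard.trans ?_
  rw [Set.encard_coe_eq_coe_finsetCard]
  exact_mod_cast Finset.card_image_le.trans (by simp)

/-- The points `γ (j / N)`, with `N` the path length, lie in squares with distinct indices. A disc
of radius `4 / M`, with `M` the grid width, can serve only indices within `5` of the floor of its
scaled centre in each coordinate, hence at most `11 ^ 2 = 121` points. -/
theorem walkLength_le_of_isCover (hX : ∀ k, X k ≤ 4 * t k) (hd : IsDir d) (hd' : IsDir d')
    (hne : d ≠ d') (hγ : ∀ x n,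
      γ x ∈ cell (gridWidth t n) (walk t X d d' n ⌊(walkLength t X n : ℝ) * x⌋)) (n : ℕ)
    {C : Finset Plane}
    (hC : Metric.IsCover (4 / gridWidth t n : NNReal) (γ '' Set.Icc 0 1) (C : Set Plane)) :
    walkLength t X n ≤ 121 * C.card := by
  have hN : (0 : ℝ) < walkLength t X n := by exact_mod_cast walkLength_pos t X n
  have hM : (0 : ℝ) < gridWidth t n := by exact_mod_cast gridWidth_pos t n
  rw [Metric.isCover_iff_subset_iUnion_closedBall] at hC
  have h1 : ∀ j : ℕ, ∃ c, j < walkLength t X n → c ∈ C ∧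
      dist (γ (j / walkLength t X n)) c ≤ 4 / gridWidth t n := by
    intro j
    by_cases hj : j < walkLength t X n
    · have hj' : (j : ℝ) ≤ walkLength t X n := by exact_mod_cast hj.le
      have := hC ⟨j / walkLength t X n, ⟨by positivity, (div_le_one hN).2 hj'⟩, rfl⟩
      simp only [Set.mem_iUnion, Metric.mem_closedBall] at this
      obtain ⟨c, hc, h⟩ := this
      exact ⟨c, fun _ => ⟨hc, by simpa using h⟩⟩
    · exact ⟨0, fun h => absurd h hj⟩
  choose c hc using h1
  rw [← Finset.card_range (walkLength t X n)]
  refine Finset.card_le_mul_card_image_of_maps_to (f := c)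
    (fun j hj => (hc j (Finset.mem_range.1 hj)).1) 121 fun z _ => ?_
  let a := ⌊(gridWidth t n : ℝ) * (z 0 - 1 / 2)⌋
  let b := ⌊(gridWidth t n : ℝ) * (z 1 - 1 / 2)⌋
  have hcard : (Finset.Icc (a - 5) (a + 5) ×ˢ Finset.Icc (b - 5) (b + 5)).card = 121 := by
    rw [Finset.card_product, Int.card_Icc, Int.card_Icc,
      show (a + 5 + 1 - (a - 5)).toNat = 11 by omega,
      show (b + 5 + 1 - (b - 5)).toNat = 11 by omega]
  rw [← hcard]
  have aux : ∀ (y w : ℝ) (p : ℤ), |y - w| ≤ 4 / gridWidth t n →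
      |(gridWidth t n : ℝ) * (y - 1 / 2) - p| ≤ 1 / 2 →
      p ∈ Finset.Icc (⌊(gridWidth t n : ℝ) * (w - 1 / 2)⌋ - 5)
        (⌊(gridWidth t n : ℝ) * (w - 1 / 2)⌋ + 5) := by
    intro y w p h2 h3
    rw [le_div_iff₀ hM, ← abs_of_pos hM, ← abs_mul, abs_le] at h2
    rw [abs_le] at h3
    have h4 := Int.floor_le ((gridWidth t n : ℝ) * (w - 1 / 2))
    have h5 := Int.lt_floor_add_one ((gridWidth t n : ℝ) * (w - 1 / 2))
    rw [Finset.mem_Icc]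
    constructor
    · have : ((⌊(gridWidth t n : ℝ) * (w - 1 / 2)⌋ - 5 : ℤ) : ℝ) ≤ p := by
        push_cast; linarith
      exact_mod_cast this
    · have : (p : ℝ) < ((⌊(gridWidth t n : ℝ) * (w - 1 / 2)⌋ + 5 + 1 : ℤ) : ℝ) := by
        push_cast; linarith
      exact Int.lt_add_one_iff.1 (by exact_mod_cast this)
  refine Finset.card_le_card_of_injOn (fun j : ℕ => walk t X d d' n j) ?_ ?_
  · intro j hj
    simp only [Finset.coe_filter, Finset.mem_range, Set.mem_ofPred_eq] at hj
    obtain ⟨hj, rfl⟩ := hj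
    have h2 := hγ (j / walkLength t X n) n
    rw [mul_div_cancel₀ _ hN.ne', Int.floor_natCast] at h2
    have h3 := (hc j hj).2
    have h4 := plane_abs_le (γ (j / walkLength t X n)) (c j)
    exact Finset.mem_coe.2 (Finset.mem_product.2
      ⟨aux _ _ _ (h4.1.trans h3) h2.1, aux _ _ _ (h4.2.trans h3) h2.2⟩)
  · have hg := goodWalk_walk hX hd hd' hne n
    have key : ∀ i j : ℕ, walk t X d d' n i = walk t X d d' n j → i ≤ j := by
      intro i j h
      have h1 := (hg (i + 1) i).2 (by omega)
      rw [h, hg] at h1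
      omega
    intro i _ j _ h
    exact le_antisymm (key i j h) (key j i h.symm)

theorem walkLength_le_covering (hX : ∀ k, X k ≤ 4 * t k) (hd : IsDir d) (hd' : IsDir d')
    (hne : d ≠ d') (hγ : ∀ x n,
      γ x ∈ cell (gridWidth t n) (walk t X d d' n ⌊(walkLength t X n : ℝ) * x⌋)) (n : ℕ) :
    walkLength t X n ≤ 121 *
      (Metric.externalCoveringNumber (4 / gridWidth t n : NNReal) (γ '' Set.Icc 0 1)).toNat := by
  have hfin : Metric.externalCoveringNumber (4 / gridWidth t n : NNReal) (γ '' Set.Icc 0 1) ≠ ⊤ :=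
    ne_top_of_le_ne_top (ENat.natCast_ne_top _) (encard_cover_le hγ n)
  obtain ⟨k, hk⟩ := ENat.ne_top_iff_exists.1 hfin
  have hlt : Metric.externalCoveringNumber (4 / gridWidth t n : NNReal) (γ '' Set.Icc 0 1) <
      ((k + 1 : ℕ) : ℕ∞) := by
    rw [← hk]; exact_mod_cast Nat.lt_succ_self k
  unfold Metric.externalCoveringNumber at hlt
  obtain ⟨C, hlt⟩ := iInf_lt_iff.1 hlt
  obtain ⟨hC, hlt⟩ := iInf_lt_iff.1 hlt
  have hCf : C.Finite := Set.finite_of_encard_le_coe hlt.le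
  have h1 := walkLength_le_of_isCover hX hd hd' hne hγ n (C := hCf.toFinset)
    (by rwa [hCf.coe_toFinset])
  rw [← hk, ENat.toNat_natCast]
  rw [hCf.encard_eq_coe_toFinset_card] at hlt
  have : hCf.toFinset.card < k + 1 := by exact_mod_cast hlt
  omega

end covering

/-! ### From grid scales to the box-counting dimension -/

/-- A criterion for the box-counting dimension: covering numbers at the scales `4 / M n`, which
decrease slowly enough, determine it. -/
theorem hasBoxDim_of_scales {F : Set Plane} (hF : F.Nonempty) (hFb : Bornology.IsBounded F)
    {M N : ℕ → ℕ} {δ B : ℝ} (hδ : δ ∈ Set.Icc (1 : ℝ) 2) (hB : 0 ≤ B) (hM0 : M 0 = 1)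
    (hMmono : Monotone M) (hNpos : ∀ n, 0 < N n)
    (hup : ∀ n, Metric.externalCoveringNumber (4 / M n : NNReal) F ≤ (N n + 1 : ℕ))
    (hlow : ∀ n, N n ≤ 121 * (Metric.externalCoveringNumber (4 / M n : NNReal) F).toNat)
    (hMgrowth : ∀ c : ℝ, ∀ᶠ n : ℕ in atTop, c * (n + 1) ≤ Real.log (M n))
    (hMN : ∀ n : ℕ, |Real.log (N n) - δ * Real.log (M n)| ≤ B * (n + 1))
    (hMstep : ∀ n : ℕ, Real.log (M (n + 1)) ≤ Real.log (M n) + B * (n + 1)) :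
    HasBoxDim F δ := by
  refine ⟨hF, hFb, ?_⟩
  have hMpos : ∀ n, (0 : ℝ) < M n := fun n => by
    have := hMmono (Nat.zero_le n)
    rw [hM0] at this
    exact_mod_cast this
  have hMpos' : ∀ n, (0 : NNReal) < M n := fun n => by exact_mod_cast hMpos n
  rw [Metric.tendsto_nhds]
  intro η hη
  -- `D * (n + 1)` absorbs the errors in `N`, the step between two scales times `δ ≤ 2`, and the
  -- logarithms of `2`, `4` and `121`.
  set D := 4 * B + 5 with hD
  have hDpos : 0 < D := by positivity
  -- The summand `2` pays for `log 4`, and the factor `2` in `2 * D / η` makes the final inequality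
  -- strict.
  obtain ⟨K, hK⟩ := eventually_atTop.1 (hMgrowth (2 * D / η + 2))
  have hIoo : Set.Ioo (0 : NNReal) (4 / M K) ∈ 𝓝[>] (0 : NNReal) :=
    Ioo_mem_nhdsGT (div_pos (by norm_num) (hMpos' K))
  filter_upwards [hIoo] with ε hε
  have hε0 : (0 : ℝ) < ε := by exact_mod_cast hε.1
  have hex : ∃ n, (4 / M n : NNReal) ≤ ε := by
    obtain ⟨n, hn⟩ := eventually_atTop.1 (hMgrowth (Real.log (4 / ε)))
    obtain ⟨n', hn'⟩ := eventually_atTop.1 (hMgrowth 0)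
    by_cases hl : 0 ≤ Real.log (4 / ε)
    · refine ⟨n, ?_⟩
      have h1 := hn n le_rfl
      have h2 : Real.log (4 / ε) ≤ Real.log (M n) := by
        refine le_trans ?_ h1
        nlinarith [(Nat.cast_nonneg n : (0 : ℝ) ≤ n)]
      rw [Real.log_le_log_iff (by positivity) (hMpos n), div_le_iff₀ hε0] at h2
      rw [div_le_iff₀ (hMpos' n), mul_comm]
      exact_mod_cast h2
    · refine ⟨n', ?_⟩
      push Not at hl
      have h2 : Real.log (4 / ε) ≤ Real.log (M n') := by
        have := hn' n' le_rfl
        rw [zero_mul] at this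
        linarith
      rw [Real.log_le_log_iff (by positivity) (hMpos n'), div_le_iff₀ hε0] at h2
      rw [div_le_iff₀ (hMpos' n'), mul_comm]
      exact_mod_cast h2
  classical
  have hKlt : K < Nat.find hex := by
    by_contra! hle
    have h1 := Nat.find_spec hex
    have h2 : (4 / M K : NNReal) ≤ 4 / M (Nat.find hex) := by
      have := hMpos' (Nat.find hex)
      have h3 : (M (Nat.find hex) : NNReal) ≤ M K := by exact_mod_cast hMmono hle
      gcongr
    exact absurd hε.2 (not_lt.2 (h2.trans h1))
  -- The radius `ε` is now enclosed between the consecutive scales `4 / M (n + 1)` and `4 / M n`,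
  -- with `n ≥ K`.
  obtain ⟨n, hn⟩ : ∃ n, Nat.find hex = n + 1 := ⟨Nat.find hex - 1, by omega⟩
  have hεup : ε < 4 / M n := not_le.1 (Nat.find_min hex (m := n) (by omega))
  have hεlow : (4 / M (n + 1) : NNReal) ≤ ε := hn ▸ Nat.find_spec hex
  have hKn := hK n (by omega)
  have hl : -Real.log ε ≤ Real.log (M (n + 1)) - Real.log 4 := by
    have : (4 / M (n + 1) : ℝ) ≤ ε := by exact_mod_cast hεlow
    have := Real.log_le_log (div_pos (by norm_num) (hMpos _)) this
    rw [Real.log_div (by norm_num) (hMpos _).ne'] at this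
    linarith
  have hl' : Real.log (M n) - Real.log 4 ≤ -Real.log ε := by
    have : (ε : ℝ) ≤ 4 / M n := by exact_mod_cast hεup.le
    have := Real.log_le_log hε0 this
    rw [Real.log_div (by norm_num) (hMpos _).ne'] at this
    linarith
  have hc1 := Metric.externalCoveringNumber_anti (A := F) hεlow
  have hc2 := Metric.externalCoveringNumber_anti (A := F) hεup.le
  have hfin : Metric.externalCoveringNumber ε F ≠ ⊤ :=
    ne_top_of_le_ne_top (ENat.natCast_ne_top _) (hc1.trans (hup _))
  have hc1' : (Metric.externalCoveringNumber ε F).toNat ≤ N (n + 1) + 1 :=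
    ENat.toNat_le_of_le_natCast (hc1.trans (hup _))
  have hc2' : N n ≤ 121 * (Metric.externalCoveringNumber ε F).toNat :=
    (hlow n).trans (Nat.mul_le_mul_left _ (ENat.toNat_le_toNat hc2 hfin))
  generalize (Metric.externalCoveringNumber ε F).toNat = k at hc1' hc2' ⊢
  have hkpos : (0 : ℝ) < k := by
    have := hNpos n
    exact_mod_cast (show 0 < k by omega)
  have hu : Real.log k ≤ Real.log 2 + Real.log (N (n + 1)) := by
    have hp : (0 : ℝ) < N (n + 1) := by exact_mod_cast hNpos (n + 1)
    rw [← Real.log_mul (by norm_num) hp.ne']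
    refine Real.log_le_log hkpos ?_
    have := hNpos (n + 1)
    exact_mod_cast (show k ≤ 2 * N (n + 1) by omega)
  have hlo : Real.log (N n) ≤ Real.log 121 + Real.log k := by
    rw [← Real.log_mul (by norm_num) hkpos.ne']
    refine Real.log_le_log (by exact_mod_cast hNpos n) ?_
    exact_mod_cast hc2'
  have l2 : Real.log 2 ≤ 1 := by
    have := Real.log_two_lt_d9; linarith
  have l4 : Real.log 4 ≤ 2 := by
    rw [show (4 : ℝ) = 2 ^ 2 by norm_num, Real.log_pow]; push_cast; linarith
  have l4' : 0 ≤ Real.log 4 := Real.log_nonneg (by norm_num)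
  have l121 : Real.log 121 ≤ 5 := by
    have h1 : Real.log 121 ≤ Real.log (2 ^ 7) := Real.log_le_log (by norm_num) (by norm_num)
    rw [Real.log_pow] at h1
    have := Real.log_two_lt_d9
    push_cast at h1
    linarith
  have m1 := abs_le.1 (hMN n)
  have m2 := abs_le.1 (hMN (n + 1))
  have m3 := hMstep n
  push_cast at m2
  set l := -Real.log ε with hldef
  have hn0 : (0 : ℝ) ≤ n := Nat.cast_nonneg n
  have hBn : 0 ≤ B * n := by positivity
  obtain ⟨hδ1, hδ2⟩ := hδ
  have hmain : |Real.log k - δ * l| ≤ D * (n + 1) := by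
    have e1 : δ * Real.log (M (n + 1)) ≤ δ * l + δ * Real.log 4 + δ * (B * (n + 1)) := by
      rw [← mul_add, ← mul_add]
      exact mul_le_mul_of_nonneg_left (by linarith) (by linarith)
    have e2 : δ * l ≤ δ * Real.log (M n) + δ * (B * (n + 1)) := by
      rw [← mul_add]
      exact mul_le_mul_of_nonneg_left (by linarith) (by linarith)
    have e3 : δ * (B * (n + 1)) ≤ 2 * (B * (n + 1)) :=
      mul_le_mul_of_nonneg_right hδ2 (by positivity)
    have e4 : δ * Real.log 4 ≤ 2 * 2 := mul_le_mul hδ2 l4 l4' (by norm_num)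
    rw [abs_le, hD]
    constructor <;> linarith
  have hlD : 2 * D / η * (n + 1) ≤ l := by linarith
  have hlpos : 0 < l := lt_of_lt_of_le (by positivity) hlD
  rw [Real.dist_eq, show Real.log k / l - δ = (Real.log k - δ * l) / l by field_simp, abs_div,
    abs_of_pos hlpos, div_lt_iff₀ hlpos]
  have e5 : D * (n + 1) * 2 ≤ η * l := by
    have := mul_le_mul_of_nonneg_left hlD hη.le
    rw [show η * (2 * D / η * ((n : ℝ) + 1)) = D * (n + 1) * 2 by field_simp] at this
    exact this
  have e6 : 0 < D * ((n : ℝ) + 1) := by positivity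
  linarith

/-! ### Choice of the parameters and the resulting estimates -/

/-- The length of the rows of the snake in the `k`-th pattern. -/
noncomputable def rowLength (δ : ℝ) (k : ℕ) : ℕ := ⌊((k + 1 : ℕ) : ℝ) ^ (δ - 1)⌋₊

section parameters

variable {δ : ℝ}

theorem rowLength_le (hδ : δ ∈ Set.Icc (1 : ℝ) 2) (k : ℕ) : rowLength δ k ≤ 4 * (k + 1) := by
  have h1 : (1 : ℝ) ≤ ((k + 1 : ℕ) : ℝ) := by push_cast; linarith [(Nat.cast_nonneg k : (0 : ℝ) ≤ k)]
  have h2 : ((k + 1 : ℕ) : ℝ) ^ (δ - 1) ≤ (k + 1 : ℕ) := by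
    conv_rhs => rw [← Real.rpow_one ((k + 1 : ℕ) : ℝ)]
    exact Real.rpow_le_rpow_of_exponent_le h1 (by linarith [hδ.2])
  have h3 : rowLength δ k ≤ k + 1 := by
    have := Nat.floor_le_floor h2
    rwa [Nat.floor_natCast] at this
  omega

/-- With `T = k + 1`, the path length lies between `T ^ δ` and `15 * T ^ δ`, and the width between
`T` and `11 * T`. Crude bounds for `log 15` and `δ * log 11` give `20`. -/
theorem log_pathLength_sub (hδ : δ ∈ Set.Icc (1 : ℝ) 2) (k : ℕ) :
    |Real.log (pathLength (k + 1) (rowLength δ k)) - δ * Real.log (8 * (k + 1) + 3 : ℕ)| ≤ 20 := by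
  obtain ⟨hδ1, hδ2⟩ := hδ
  set T : ℝ := ((k + 1 : ℕ) : ℝ) with hT
  have hT1 : 1 ≤ T := by rw [hT]; push_cast; linarith [(Nat.cast_nonneg k : (0 : ℝ) ≤ k)]
  have hT0 : 0 < T := by linarith
  set y : ℝ := T ^ (δ - 1) with hy
  have hy1 : 1 ≤ y := Real.one_le_rpow hT1 (by linarith)
  have hx1 : (rowLength δ k : ℝ) ≤ y := Nat.floor_le (by linarith)
  have hx2 : y < rowLength δ k + 1 := Nat.lt_floor_add_one y
  have hTy : δ * Real.log T = Real.log (T * y) := by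
    rw [Real.log_mul (by linarith) (by linarith), hy, Real.log_rpow hT0]
    ring
  have hL : (pathLength (k + 1) (rowLength δ k) : ℝ) = 3 + 4 * (T * (rowLength δ k + 2)) := by
    rw [pathLength, armLength, hT]
    push_cast
    ring
  have hTy1 : 1 ≤ T * y := by nlinarith
  have hL1 : T * y ≤ pathLength (k + 1) (rowLength δ k) := by
    rw [hL]; nlinarith
  have hL2 : (pathLength (k + 1) (rowLength δ k) : ℝ) ≤ 15 * (T * y) := by
    rw [hL]; nlinarith
  have l1 : Real.log (T * y) ≤ Real.log (pathLength (k + 1) (rowLength δ k)) :=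
    Real.log_le_log (by positivity) hL1
  have l2 : Real.log (pathLength (k + 1) (rowLength δ k)) ≤ Real.log 15 + Real.log (T * y) := by
    rw [← Real.log_mul (by norm_num) (by positivity)]
    exact Real.log_le_log (by linarith) hL2
  have hm : ((8 * (k + 1) + 3 : ℕ) : ℝ) = 8 * T + 3 := by rw [hT]; push_cast; ring
  have l3 : Real.log T ≤ Real.log (8 * (k + 1) + 3 : ℕ) := by
    rw [hm]; exact Real.log_le_log hT0 (by linarith)
  have l4 : Real.log (8 * (k + 1) + 3 : ℕ) ≤ Real.log 11 + Real.log T := by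
    rw [hm, ← Real.log_mul (by norm_num) hT0.ne']
    exact Real.log_le_log (by linarith) (by linarith)
  have l15 : Real.log 15 ≤ 15 - 1 := Real.log_le_sub_one_of_pos (by norm_num)
  have l11 : Real.log 11 ≤ 11 - 1 := Real.log_le_sub_one_of_pos (by norm_num)
  have l11' : 0 ≤ Real.log 11 := Real.log_nonneg (by norm_num)
  have e1 : δ * Real.log T ≤ δ * Real.log (8 * (k + 1) + 3 : ℕ) :=
    mul_le_mul_of_nonneg_left l3 (by linarith)
  have e2 : δ * Real.log (8 * (k + 1) + 3 : ℕ) ≤ δ * Real.log 11 + δ * Real.log T := by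
    rw [← mul_add]; exact mul_le_mul_of_nonneg_left l4 (by linarith)
  have e3 : δ * Real.log 11 ≤ 2 * 10 := mul_le_mul hδ2 (by linarith) l11' (by norm_num)
  rw [abs_le]
  constructor <;> linarith

theorem log_walkLength_sub (hδ : δ ∈ Set.Icc (1 : ℝ) 2) (n : ℕ) :
    |Real.log (walkLength (fun k => k + 1) (rowLength δ) n) -
      δ * Real.log (gridWidth (fun k => k + 1) n)| ≤ 20 * n := by
  induction n with
  | zero => simp [walkLength, gridWidth]
  | succ n ih =>
    have h1 : ((walkLength (fun k => k + 1) (rowLength δ) n : ℕ) : ℝ) ≠ 0 := by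
      exact_mod_cast (walkLength_pos _ _ n).ne'
    have h2 : ((gridWidth (fun k => k + 1) n : ℕ) : ℝ) ≠ 0 := by
      exact_mod_cast (gridWidth_pos _ n).ne'
    have h3 : ((pathLength (n + 1) (rowLength δ n) : ℕ) : ℝ) ≠ 0 := by
      exact_mod_cast (pathLength_pos _ _).ne'
    rw [walkLength_succ, gridWidth_succ, Nat.cast_mul, Nat.cast_mul, Real.log_mul h1 h3,
      Real.log_mul h2 (by positivity)]
    have h4 := abs_le.1 (log_pathLength_sub hδ n)
    have h5 := abs_le.1 ih
    rw [abs_le]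
    push_cast at *
    constructor <;> linarith

theorem factorial_le_gridWidth (n : ℕ) : n.factorial ≤ gridWidth (fun k => k + 1) n := by
  induction n with
  | zero => simp [gridWidth]
  | succ n ih =>
    rw [Nat.factorial_succ, gridWidth_succ, mul_comm]
    exact Nat.mul_le_mul ih (by omega)

/-- This is why the widths must grow: the factorial beats every exponential, so the accumulated
error `20 * n` is negligible against `log (M n)`, with `M n` the grid width. -/
theorem eventually_le_log_gridWidth (c : ℝ) :
    ∀ᶠ n : ℕ in atTop, c * (n + 1) ≤ Real.log (gridWidth (fun k => k + 1) n) := by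
  have h := FloorSemiring.tendsto_pow_div_factorial_atTop (Real.exp c)
  filter_upwards [h.eventually (gt_mem_nhds (Real.exp_pos (-c)))] with n hn
  have hf : (0 : ℝ) < n.factorial := by exact_mod_cast n.factorial_pos
  rw [div_lt_iff₀ hf] at hn
  have h1 : Real.exp (c * (n + 1)) ≤ n.factorial := by
    have e : Real.exp (c * (n + 1)) = Real.exp c * Real.exp c ^ n := by
      rw [← Real.exp_nat_mul, ← Real.exp_add]; congr 1; ring
    rw [e]
    calc Real.exp c * Real.exp c ^ n ≤ Real.exp c * (Real.exp (-c) * n.factorial) :=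
          mul_le_mul_of_nonneg_left hn.le (Real.exp_pos c).le
      _ = n.factorial := by rw [← mul_assoc, ← Real.exp_add]; simp
  rw [← Real.log_exp (c * (n + 1))]
  refine Real.log_le_log (Real.exp_pos _) (h1.trans ?_)
  exact_mod_cast factorial_le_gridWidth n

theorem log_gridWidth_succ_le (n : ℕ) : Real.log (gridWidth (fun k => k + 1) (n + 1)) ≤
    Real.log (gridWidth (fun k => k + 1) n) + 20 * (n + 1) := by
  have h2 : ((gridWidth (fun k => k + 1) n : ℕ) : ℝ) ≠ 0 := by
    exact_mod_cast (gridWidth_pos _ n).ne'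
  rw [gridWidth_succ, Nat.cast_mul, Real.log_mul h2 (by positivity)]
  have h3 : Real.log (8 * (n + 1) + 3 : ℕ) ≤ (8 * (n + 1) + 3 : ℕ) - 1 :=
    Real.log_le_sub_one_of_pos (by positivity)
  push_cast at h3 ⊢
  linarith [(Nat.cast_nonneg n : (0 : ℝ) ≤ n)]

end parameters

theorem monotone_gridWidth (t : ℕ → ℕ) : Monotone (gridWidth t) :=
  monotone_nat_of_le_succ fun n => by
    rw [gridWidth_succ]; exact Nat.le_mul_of_pos_right _ (by omega)

theorem isArc_image {γ : ℝ → Plane} (hγ : Continuous γ) (hinj : Function.Injective γ)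
    {x y : Plane} (h0 : γ 0 = x) (h1 : γ 1 = y) : IsArc (γ '' Set.Icc 0 1) x y := by
  refine ⟨⟨⟨fun s => γ s, by fun_prop⟩, by simpa using h0, by simpa using h1⟩, ?_, ?_⟩
  · intro a b h
    exact Subtype.ext (hinj h)
  · ext z
    constructor
    · rintro ⟨s, rfl⟩
      exact ⟨s, s.2, rfl⟩
    · rintro ⟨s, hs, rfl⟩
      exact ⟨⟨s, hs⟩, rfl⟩

end Labyrinth

/-- For every `δ ∈ [1, 2]` there is a mixed labyrinth fractal such that any two of its four exits
(exactly one on each side) are connected in the fractal by an arc of box-counting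
dimension `δ`. -/
theorem theorem4 (δ : ℝ) (hδ : δ ∈ Set.Icc (1 : ℝ) 2) :
    ∃ A : ℕ → Labyrinth.Pattern, (∀ k, (A k).IsLabyrinth) ∧
      ∃ e : Labyrinth.Side → Labyrinth.Plane,
        (∀ (s : Labyrinth.Side) (x : Labyrinth.Plane),
          Labyrinth.IsFractalExit A s x ↔ x = e s) ∧
        ∀ s t : Labyrinth.Side, s ≠ t →
          ∃ a : Set Labyrinth.Plane, a ⊆ Labyrinth.limitSet A ∧
            Labyrinth.IsArc a (e s) (e t) ∧ Labyrinth.HasBoxDim a δ := by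
  have hX := Labyrinth.rowLength_le hδ
  refine ⟨fun k => Labyrinth.snakePattern (k + 1) (Labyrinth.rowLength δ k) (hX k),
    fun k => Labyrinth.snakePattern_isLabyrinth _ _ _, fun s => Labyrinth.sideMidpoint s.dir,
    fun s x => Labyrinth.isFractalExit_iff (t := fun k => k + 1) hX s x, fun s s' hs => ?_⟩
  have hne : s.dir ≠ s'.dir := fun h => hs (Labyrinth.Side.dir_injective h)
  have hd := s.isDir_dir
  have hd' := s'.isDir_dir
  obtain ⟨γ, hγ⟩ := Labyrinth.exists_curve (t := fun k => k + 1) hX hd hd' hne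
  have hcont := Labyrinth.curve_continuous hγ hX hd hd' hne
  refine ⟨γ '' Set.Icc 0 1, Labyrinth.curve_image_subset hX hγ hd hd' hne,
    Labyrinth.isArc_image hcont (Labyrinth.curve_injective hγ hX hd hd' hne)
      (Labyrinth.curve_zero hγ hd) (Labyrinth.curve_one hγ hd'), ?_⟩
  refine Labyrinth.hasBoxDim_of_scales (M := Labyrinth.gridWidth fun k => k + 1)
    (N := Labyrinth.walkLength (fun k => k + 1) (Labyrinth.rowLength δ)) (B := 20)
    ((Set.nonempty_Icc.2 zero_le_one).image γ) (isCompact_Icc.image hcont).isBounded hδ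
    (by norm_num) (by simp [Labyrinth.gridWidth]) (Labyrinth.monotone_gridWidth _)
    (Labyrinth.walkLength_pos _ _) (Labyrinth.encard_cover_le hγ)
    (Labyrinth.walkLength_le_covering hX hd hd' hne hγ) Labyrinth.eventually_le_log_gridWidth
    (fun n => (Labyrinth.log_walkLength_sub hδ n).trans (by linarith))
    Labyrinth.log_gridWidth_succ_le
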